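/- All graphs are finite, simple and have at least one vertex. For an integer $k\ge 1$, an edge-colouring $\Gamma:E(G)\to\mathbb N$ of a graph $G$ (adjacent edges may have the same colour) is an $MC_k$-colouring if every two distinct vertices of $G$ are joined by at least $k$ pairwise edge-disjoint monochromatic paths, where a path is monochromatic if all its edges have the same colour, and different paths may have different colours. If $G$ has an $MC_k$-colouring, $mc_k(G)$ denotes the maximum number of colours used by an $MC_k$-colouring of $G$. A block of $G$ is a maximal connected subgraph of $G$ without a cut vertex of its own. Let $G$ be a $2$-edge-connected graph with $n$ vertices and $e(G)$ edges, and let $B_1,\dots,B_t$ be its distinct blocks. Then $G$ and each $B_i$ have an $MC_2$-colouring (so that $mc_2(G)$ and all $mc_2(B_i)$ are defined), $$mc_2(G)=\sum_{i=1}^{t}mc_2(B_i)-t+1,\qquad\text{and}\qquad mc_2(G)\le e(G)-n-t+2.$$ -/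

import Mathlib

namespace SimpleGraph

section MonochromaticEdgeConnection

variable {V : Type*} {G : SimpleGraph V}

/-- A walk in an edge-coloured graph is monochromatic if all of its edges have the same colour. -/
def Walk.IsMonochromatic {u v : V} (p : G.Walk u v) (Γ : G.edgeSet → ℕ) : Prop :=
  ∃ c : ℕ, ∀ (e : Sym2 V) (he : e ∈ p.edges), Γ ⟨e, p.edges_subset_edgeSet he⟩ = c

/-- An edge-colouring is an `MC_k`-colouring if any two distinct vertices are joined by `k`
pairwise edge-disjoint monochromatic paths (different paths may have different colours). -/
def IsMCColoring (k : ℕ) (Γ : G.edgeSet → ℕ) : Prop :=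
  ∀ u v : V, u ≠ v → ∃ P : Fin k → G.Path u v,
    (∀ i, (P i : G.Walk u v).IsMonochromatic Γ) ∧
    ∀ i j, i ≠ j → List.Disjoint (P i : G.Walk u v).edges (P j : G.Walk u v).edges

/-- The numbers of colours that are used by the `MC_k`-colourings of `G`. -/
def mcColorCounts (k : ℕ) (G : SimpleGraph V) : Set ℕ :=
  {m | ∃ Γ : G.edgeSet → ℕ, IsMCColoring k Γ ∧ (Set.range Γ).ncard = m}

/-- The monochromatic `k`-edge-connection number `mc_k(G)` of a finite graph `G`: the maximum
number of colours used by an `MC_k`-colouring of `G`. -/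
noncomputable def mc (k : ℕ) (G : SimpleGraph V) : ℕ :=
  sSup (mcColorCounts k G)

/-- For a finite graph, the supremum that defines `mc_k(G)` is a maximum as soon as `G` has an
`MC_k`-colouring at all. -/
theorem mc_isGreatest [Finite V] (k : ℕ) (G : SimpleGraph V)
    (h : (mcColorCounts k G).Nonempty) : IsGreatest (mcColorCounts k G) (mc k G) := by
  have hb : BddAbove (mcColorCounts k G) := by
    refine ⟨Nat.card G.edgeSet, ?_⟩
    rintro m ⟨Γ, -, rfl⟩
    rw [← Set.image_univ, ← Set.ncard_univ]
    exact Set.ncard_image_le Set.finite_univ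
  exact ⟨Nat.sSup_mem h hb, fun m hm => le_csSup hb hm⟩

/-- A subgraph is nonseparable if it is connected (hence nonempty) and has no cut vertex. -/
def Subgraph.IsNonseparable (H : G.Subgraph) : Prop :=
  H.Connected ∧ ∀ v ∈ H.verts, (H.deleteVerts {v}).Preconnected

/-- A block of `G` is a maximal nonseparable subgraph of `G`. -/
def Subgraph.IsBlock (H : G.Subgraph) : Prop :=
  Maximal Subgraph.IsNonseparable H

end MonochromaticEdgeConnection

end SimpleGraph

/-! The core is the identity `mc 2 G = e(G) - e(H) + 1`, where `H` is a 2-edge-connected spanning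
subgraph of `G` with fewest edges (`IsEdgeConnected.exists_mc_two_add_eq`, for at least two
vertices). For the lower bound, `H` gets one colour and every other edge its own.

For the upper bound, the colour classes of an `MC_2`-colouring are split into connected pieces `C
i`, which form an `IsColorFamily`. There are at least as many pieces as colours, and at most `e(G) -
∑ (e(C i) - 1)`, so it suffices to find a 2-edge-connected spanning subgraph with at most `1 + ∑
(e(C i) - 1)` edges (`exists_spanning_isEdgeConnected_two`). Such a subgraph is built by merging
2-edge-reachability classes: a cycle of `ℓ` classes costs `ℓ` edges and removes `ℓ - 1` classes, and
two edges per lost class always suffice. Starting with a cycle at the end of a longest path saves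
edges in terms of the degree of a vertex `w`. Double counting of the colours at `w` and of those
avoiding `w` shows that the family pays for the rest; a spanning colour is treated separately.

Minimum 2-edge-connected spanning subgraphs split along blocks: restriction to a block and union
over all blocks both preserve 2-edge-connectedness. Hence the numbers `e(B i) - e(K i) = mc 2 (B i)
- 1` add up. The inequality follows from `e(K i) ≥ |B i|` and `∑ (|B i| - 1) ≥ n - 1`. -/

namespace SimpleGraph

/-! ### Merging 2-edge-reachability classes with few edges -/

section TwoEdgeClasses

variable {V : Type*} {G H K : SimpleGraph V}

/-- The equivalence relation of being `2`-edge-reachable. -/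
def twoEdgeSetoid (H : SimpleGraph V) : Setoid V where
  r := H.IsEdgeReachable 2
  iseqv := ⟨fun _ => .rfl, fun h => h.symm, fun h h' => h.trans h'⟩

theorem twoEdgeSetoid_mk_eq {x y : V} :
    (Quotient.mk H.twoEdgeSetoid x = Quotient.mk H.twoEdgeSetoid y) ↔
      H.IsEdgeReachable 2 x y :=
  Quotient.eq (r := H.twoEdgeSetoid)

/-- The simple graph that `G` induces on the `2`-edge-reachability classes of `H`. -/
def classGraph (G H : SimpleGraph V) : SimpleGraph (Quotient H.twoEdgeSetoid) where
  Adj a b := a ≠ b ∧ ∃ u v, Quotient.mk _ u = a ∧ Quotient.mk _ v = b ∧ G.Adj u v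
  symm := ⟨fun _ _ ⟨h, u, v, hu, hv, huv⟩ => ⟨h.symm, v, u, hv, hu, huv.symm⟩⟩
  loopless := ⟨fun _ h => h.1 rfl⟩

/-- Lifts a walk of classes to `K`: each step is realised by an edge of `K`, and `hK` joins the ends
of consecutive edges inside a class. -/
theorem reachable_of_classes_reachable {D : SimpleGraph (Quotient H.twoEdgeSetoid)}
    (hK : ∀ u v, H.IsEdgeReachable 2 u v → K.Reachable u v)
    (hD : ∀ a b, D.Adj a b → ∃ u v, Quotient.mk _ u = a ∧ Quotient.mk _ v = b ∧ K.Adj u v)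
    {a b : Quotient H.twoEdgeSetoid} (hab : D.Reachable a b) :
    ∀ {x y : V}, Quotient.mk _ x = a → Quotient.mk _ y = b → K.Reachable x y := by
  obtain ⟨p⟩ := hab
  induction p with
  | nil => exact fun hx hy => hK _ _ (twoEdgeSetoid_mk_eq.1 (hx.trans hy.symm))
  | cons h p ih =>
    intro x y hx hy
    obtain ⟨u, v, hu, hv, huv⟩ := hD _ _ h
    exact (hK _ _ (twoEdgeSetoid_mk_eq.1 (hx.trans hu.symm))).trans
      (huv.reachable.trans (ih hv hy))

/-- Adding one edge of `G` for each edge of a cycle of classes merges the classes of the cycle. -/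
theorem exists_merge_cycle [Finite V] (hHG : H ≤ G) {a : Quotient H.twoEdgeSetoid}
    (c : (classGraph G H).Walk a a) (hc : c.IsCycle) :
    ∃ K, H ≤ K ∧ K ≤ G ∧ K.edgeSet.ncard ≤ H.edgeSet.ncard + c.length ∧
      ∀ x y, Quotient.mk _ x ∈ c.support → Quotient.mk _ y ∈ c.support →
        K.IsEdgeReachable 2 x y := by
  classical
  have hrep : ∀ q : Sym2 (Quotient H.twoEdgeSetoid), q ∈ (classGraph G H).edgeSet →
      ∃ e ∈ G.edgeSet, Sym2.map (Quotient.mk H.twoEdgeSetoid) e = q := by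
    intro q
    induction q with
    | h a b =>
      rintro ⟨-, u, v, rfl, rfl, huv⟩
      exact ⟨s(u, v), huv, rfl⟩
  have : Nonempty (Sym2 V) := a.exists_rep.elim fun v _ => ⟨s(v, v)⟩
  choose! rep hrepG hrepq using hrep
  have hsub : ∀ q ∈ c.edges, q ∈ (classGraph G H).edgeSet := fun q hq =>
    c.edges_subset_edgeSet hq
  set E : Set (Sym2 V) := rep '' {q | q ∈ c.edges} with hE
  refine ⟨H ⊔ fromEdgeSet E, le_sup_left, sup_le hHG ?_, ?_, ?_⟩
  · rw [← edgeSet_subset_edgeSet]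
    intro e he
    rw [edgeSet_fromEdgeSet] at he
    obtain ⟨q, hq, rfl⟩ := he.1
    exact hrepG q (hsub q hq)
  · have h1 : (H ⊔ fromEdgeSet E).edgeSet ⊆ H.edgeSet ∪ E := by
      rw [edgeSet_sup, edgeSet_fromEdgeSet]
      exact Set.union_subset_union_right _ Set.sdiff_subset
    have h2 : {q | q ∈ c.edges}.ncard ≤ c.length := by
      have : {q | q ∈ c.edges} = (c.edges.toFinset : Set _) := by ext; simp
      rw [this, Set.ncard_coe_finset, ← c.length_edges]
      exact List.toFinset_card_le _
    have hfin : {q | q ∈ c.edges}.Finite := List.finite_toSet _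
    calc _ ≤ (H.edgeSet ∪ E).ncard := Set.ncard_le_ncard h1 (Set.toFinite _)
      _ ≤ _ := (Set.ncard_union_le _ _).trans (by
        gcongr
        exact (Set.ncard_image_le hfin).trans h2)
  · intro x y hx hy
    rw [isEdgeReachable_two]
    intro e
    -- Deleting `e` kills at most one edge of the class cycle `D`, namely the image of `e`. The
    -- cycle stays connected, and so does each class, being 2-edge-reachable in `H`.
    set D : SimpleGraph (Quotient H.twoEdgeSetoid) := fromEdgeSet {q | q ∈ c.edges} with hD
    have hcD : ∀ q ∈ c.edges, q ∈ D.edgeSet := by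
      intro q hq
      rw [hD, edgeSet_fromEdgeSet]
      exact ⟨hq, (classGraph G H).not_isDiag_of_mem_edgeSet (hsub q hq)⟩
    have hreach := isEdgeReachable_two.1 ((hc.transfer hcD).isTrail.isEdgeReachable_two
      (x := Quotient.mk _ x) (y := Quotient.mk _ y) (by simpa using hx) (by simpa using hy))
      (Sym2.map (Quotient.mk H.twoEdgeSetoid) e)
    refine reachable_of_classes_reachable (fun u v huv => ?_) (fun a b hab => ?_) hreach rfl rfl
    · exact isEdgeReachable_two.1 (huv.mono le_sup_left) e
    · rw [deleteEdges_adj, hD, fromEdgeSet_adj] at hab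
      obtain ⟨⟨hab, hne⟩, hne'⟩ := hab
      have hq := hrepq _ (hsub _ hab)
      have hG := hrepG _ (hsub _ hab)
      have hEm : rep s(a, b) ∈ E := ⟨_, hab, rfl⟩
      have hee : rep s(a, b) ≠ e := by
        rintro rfl
        exact hne' (by simp [hq])
      generalize rep s(a, b) = f at *
      induction f with
      | h u v =>
        have key : ∀ u v, s(u, v) ∈ G.edgeSet → s(u, v) ∈ E → s(u, v) ≠ e →
            ((H ⊔ fromEdgeSet E).deleteEdges {e}).Adj u v := by
          intro u v h1 h2 h3
          rw [deleteEdges_adj]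
          exact ⟨Or.inr ((fromEdgeSet_adj E).2 ⟨h2, G.ne_of_adj h1⟩), h3⟩
        rw [Sym2.map_mk, Sym2.eq_iff] at hq
        rcases hq with ⟨h1, h2⟩ | ⟨h1, h2⟩
        · exact ⟨u, v, h1, h2, key u v hG hEm hee⟩
        · exact ⟨v, u, h2, h1, (key u v hG hEm hee).symm⟩

/-- Classes of `K` are unions of classes of `H`, so one member of `S` together with the complement
of `S` already meets every class of `K`. -/
theorem card_classes_add_le [Finite V] (hHK : H ≤ K) (S : Finset (Quotient H.twoEdgeSetoid))
    (hS : ∀ x y, Quotient.mk _ x ∈ S → Quotient.mk _ y ∈ S → K.IsEdgeReachable 2 x y)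
    (hne : S.Nonempty) :
    Nat.card (Quotient K.twoEdgeSetoid) + S.card ≤ Nat.card (Quotient H.twoEdgeSetoid) + 1 := by
  classical
  have := Fintype.ofFinite (Quotient K.twoEdgeSetoid)
  have := Fintype.ofFinite (Quotient H.twoEdgeSetoid)
  let f : Quotient H.twoEdgeSetoid → Quotient K.twoEdgeSetoid :=
    Quotient.map' id (fun _ _ h => IsEdgeReachable.mono hHK h)
  obtain ⟨s, hs⟩ := hne
  have hsurj : (insert s Sᶜ).image f = Finset.univ := by
    refine Finset.eq_univ_of_forall fun z => ?_
    induction z using Quotient.inductionOn with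
    | h z =>
      rw [Finset.mem_image]
      by_cases hz : Quotient.mk H.twoEdgeSetoid z ∈ S
      · refine ⟨s, Finset.mem_insert_self _ _, ?_⟩
        induction s using Quotient.inductionOn with
        | h s => exact twoEdgeSetoid_mk_eq.2 (hS _ _ hs hz)
      · exact ⟨Quotient.mk _ z, by simp [hz], rfl⟩
  have h1 : Fintype.card (Quotient K.twoEdgeSetoid) ≤ Sᶜ.card + 1 := by
    rw [← Finset.card_univ, ← hsurj]
    exact Finset.card_image_le.trans (Finset.card_insert_le _ _)
  rw [Nat.card_eq_fintype_card, Nat.card_eq_fintype_card]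
  have := Finset.card_add_card_compl S
  omega

/-- If `H` is not `2`-edge-connected, some of its classes can be merged at the cost of at most two
edges per class that disappears. -/
theorem exists_merge [Finite V] (hG : G.IsEdgeConnected 2) (hHG : H ≤ G)
    (hH : ¬ H.IsEdgeConnected 2) :
    ∃ K, H ≤ K ∧ K ≤ G ∧
      Nat.card (Quotient K.twoEdgeSetoid) < Nat.card (Quotient H.twoEdgeSetoid) ∧
      K.edgeSet.ncard + 2 * Nat.card (Quotient K.twoEdgeSetoid) ≤
        H.edgeSet.ncard + 2 * Nat.card (Quotient H.twoEdgeSetoid) := by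
  classical
  obtain ⟨u, v, huv, hne⟩ : ∃ u v, G.Adj u v ∧ ¬ H.IsEdgeReachable 2 u v := by
    by_contra! hcon
    refine hH fun x y => ?_
    obtain ⟨p⟩ := (hG x y).reachable (by simp)
    induction p with
    | nil => rfl
    | cons h p ih => exact (hcon _ _ h).trans ih
  have hne' : Quotient.mk H.twoEdgeSetoid u ≠ Quotient.mk H.twoEdgeSetoid v :=
    fun h => hne (twoEdgeSetoid_mk_eq.1 h)
  have hadj : (classGraph G H).Adj (Quotient.mk _ u) (Quotient.mk _ v) :=
    ⟨hne', u, v, rfl, rfl, huv⟩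
  -- If the class edge lies on a cycle of length `ℓ ≥ 3`, then `ℓ` edges remove at least `ℓ - 1`
  -- classes, and `ℓ ≤ 2 * (ℓ - 1)`. If it is a bridge of the class graph, then, as `G` has no
  -- bridge, a second edge of `G` joins the same two classes; both edges are added.
  by_cases hbr : ((classGraph G H).deleteEdges
      {s(Quotient.mk _ u, Quotient.mk _ v)}).Reachable (Quotient.mk _ u) (Quotient.mk _ v)
  · obtain ⟨a, c, hc, -⟩ := adj_and_reachable_delete_edges_iff_exists_cycle.1 ⟨hadj, hbr⟩
    obtain ⟨K, hHK, hKG, hcard, hmerge⟩ := exists_merge_cycle hHG c hc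
    have hlen : c.support.toFinset.card = c.length := by
      have h1 : c.support.toFinset = c.support.tail.toFinset := by
        ext z
        rw [List.mem_toFinset, List.mem_toFinset, c.mem_support_iff]
        refine ⟨?_, Or.inr⟩
        rintro (rfl | h)
        · exact Walk.end_mem_tail_support hc.not_nil
        · exact h
      rw [h1, List.toFinset_card_of_nodup hc.support_nodup, List.length_tail, c.length_support]
      simp
    have := card_classes_add_le hHK c.support.toFinset
      (fun x y hx hy => hmerge x y (by simpa using hx) (by simpa using hy))
      ⟨a, by simp⟩
    have := hc.three_le_length
    exact ⟨K, hHK, hKG, by omega, by omega⟩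
  · obtain ⟨u', v', hu', hv', huv', hne2⟩ : ∃ u' v', H.IsEdgeReachable 2 u u' ∧
        H.IsEdgeReachable 2 v' v ∧ G.Adj u' v' ∧ s(u', v') ≠ s(u, v) := by
      by_contra! hcon
      obtain ⟨p⟩ := isEdgeReachable_two.1 (hG u v) s(u, v)
      refine hbr ?_
      clear hbr
      have key : ∀ {x y : V}, (G.deleteEdges {s(u, v)}).Walk x y →
          ((classGraph G H).deleteEdges
            {s(Quotient.mk _ u, Quotient.mk _ v)}).Reachable (Quotient.mk _ x)
              (Quotient.mk _ y) := by
        intro x y p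
        induction p with
        | nil => rfl
        | @cons x z y h p ih =>
          refine Reachable.trans ?_ ih
          rw [deleteEdges_adj] at h
          by_cases hxz : Quotient.mk H.twoEdgeSetoid x = Quotient.mk H.twoEdgeSetoid z
          · rw [hxz]
          · refine Adj.reachable ?_
            rw [deleteEdges_adj]
            refine ⟨⟨hxz, x, z, rfl, rfl, h.1⟩, fun hq => h.2 ?_⟩
            rw [Set.mem_singleton_iff, Sym2.eq_iff] at hq
            rcases hq with ⟨h1, h2⟩ | ⟨h1, h2⟩
            · exact hcon x z (twoEdgeSetoid_mk_eq.1 h1.symm) (twoEdgeSetoid_mk_eq.1 h2) h.1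
            · rw [Set.mem_singleton_iff, Sym2.eq_swap]
              exact hcon z x (twoEdgeSetoid_mk_eq.1 h2.symm) (twoEdgeSetoid_mk_eq.1 h1) h.1.symm
      exact key p
    refine ⟨H ⊔ fromEdgeSet {s(u, v), s(u', v')}, le_sup_left, sup_le hHG ?_, ?_⟩
    · rw [← edgeSet_subset_edgeSet, edgeSet_fromEdgeSet]
      rintro e ⟨rfl | rfl, -⟩
      · exact huv
      · exact huv'
    · set K := H ⊔ fromEdgeSet {s(u, v), s(u', v')} with hK
      have hHK : H ≤ K := le_sup_left
      have hKuv : K.Adj u v := Or.inr ((fromEdgeSet_adj _).2 ⟨by simp, huv.ne⟩)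
      have hKuv' : K.Adj u' v' := Or.inr ((fromEdgeSet_adj _).2 ⟨by simp, huv'.ne⟩)
      have h2 : K.IsEdgeReachable 2 u v := by
        rw [isEdgeReachable_two]
        intro e
        by_cases he : s(u, v) = e
        · subst he
          have h3 : (K.deleteEdges {s(u, v)}).Adj u' v' := by
            rw [deleteEdges_adj]
            exact ⟨hKuv', hne2⟩
          exact (isEdgeReachable_two.1 (hu'.mono hHK) _).trans
            (h3.reachable.trans (isEdgeReachable_two.1 (hv'.mono hHK) _))
        · exact Adj.reachable (deleteEdges_adj.2 ⟨hKuv, he⟩)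
      have hcl := card_classes_add_le hHK {Quotient.mk _ u, Quotient.mk _ v} (by
        intro x y hx hy
        simp only [Finset.mem_insert, Finset.mem_singleton, twoEdgeSetoid_mk_eq] at hx hy
        have hx' : K.IsEdgeReachable 2 x u := by
          rcases hx with hx | hx
          · exact hx.mono hHK
          · exact (hx.mono hHK).trans h2.symm
        have hy' : K.IsEdgeReachable 2 y u := by
          rcases hy with hy | hy
          · exact hy.mono hHK
          · exact (hy.mono hHK).trans h2.symm
        exact hx'.trans hy'.symm) (by simp)
      rw [Finset.card_pair hne'] at hcl
      have he : K.edgeSet.ncard ≤ H.edgeSet.ncard + 2 := by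
        have h1 : K.edgeSet ⊆ H.edgeSet ∪ {s(u, v), s(u', v')} := by
          rw [hK, edgeSet_sup, edgeSet_fromEdgeSet]
          exact Set.union_subset_union_right _ Set.sdiff_subset
        refine (Set.ncard_le_ncard h1 (Set.toFinite _)).trans ((Set.ncard_union_le _ _).trans ?_)
        gcongr
        exact (Set.ncard_insert_le _ _).trans (by simp)
      omega

/-- Iterating `exists_merge` down to one class pays at most two edges for each of the lost classes.
-/
theorem exists_isEdgeConnected_two_between [Finite V] [Nonempty V] (hG : G.IsEdgeConnected 2)
    (hHG : H ≤ G) :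
    ∃ K, H ≤ K ∧ K ≤ G ∧ K.IsEdgeConnected 2 ∧
      K.edgeSet.ncard + 2 ≤ H.edgeSet.ncard + 2 * Nat.card (Quotient H.twoEdgeSetoid) := by
  induction hp : Nat.card (Quotient H.twoEdgeSetoid) using Nat.strong_induction_on
    generalizing H with
  | h p ih =>
    by_cases hH : H.IsEdgeConnected 2
    · refine ⟨H, le_rfl, hHG, hH, ?_⟩
      have : Nonempty (Quotient H.twoEdgeSetoid) := ⟨Quotient.mk _ (Classical.arbitrary V)⟩
      have : 0 < Nat.card (Quotient H.twoEdgeSetoid) := Nat.card_pos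
      omega
    · obtain ⟨K, hHK, hKG, hlt, hle⟩ := exists_merge hG hHG hH
      obtain ⟨K', h1, h2, h3, h4⟩ := ih _ (hp ▸ hlt) hKG rfl
      exact ⟨K', hHK.trans h1, h2, h3, by omega⟩

/-- The end of a longest path lies next to a cycle that is longer than its degree. -/
theorem exists_vertex_cycle_length_gt [Finite V] [Nonempty V] (G : SimpleGraph V) :
    ∃ b, (G.neighborSet b).ncard ≤ 1 ∨
      ∃ a, ∃ c : G.Walk a a, c.IsCycle ∧ (G.neighborSet b).ncard + 1 ≤ c.length := by
  classical
  obtain ⟨u, v, p, hp, hmax⟩ := Walk.exists_isPath_forall_isPath_length_le_length G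
  refine ⟨u, or_iff_not_imp_left.2 fun hdeg => ?_⟩
  have hnb : ∀ x, G.Adj u x → x ∈ p.support := by
    intro x hx
    by_contra hxp
    have := hmax _ _ (Walk.cons hx.symm p) (hp.cons hxp)
    simp at this
  let S : Finset ℕ := (Finset.range (p.length + 1)).filter fun i => G.Adj u (p.getVert i)
  have hmemS : ∀ x, G.Adj u x → ∃ i ∈ S, p.getVert i = x := by
    intro x hx
    obtain ⟨i, hi, hle⟩ := Walk.mem_support_iff_exists_getVert.1 (hnb x hx)
    exact ⟨i, by simp [S, hi, hx]; omega, hi⟩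
  have hSne : S.Nonempty := by
    by_contra hS
    rw [Finset.not_nonempty_iff_eq_empty] at hS
    refine hdeg ?_
    have : G.neighborSet u = ∅ := by
      ext x
      simp only [mem_neighborSet, Set.mem_empty_iff_false, iff_false]
      intro hx
      obtain ⟨i, hi, -⟩ := hmemS x hx
      simp [hS] at hi
    simp [this]
  -- All neighbours of the end `u` lie on the longest path. The farthest, at position `k`, closes a
  -- cycle of length `k + 1`, and the degree is at most `k`.
  obtain ⟨k, hk, hkmax⟩ := S.exists_max_image id hSne
  have hkS := hk
  simp only [S, Finset.mem_filter, Finset.mem_range] at hk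
  have hsub : G.neighborSet u ⊆ p.getVert '' (Finset.Icc 1 k : Finset ℕ) := by
    intro x hx
    obtain ⟨i, hi, rfl⟩ := hmemS x hx
    refine ⟨i, ?_, rfl⟩
    simp only [Finset.coe_Icc, Set.mem_Icc]
    refine ⟨?_, hkmax i hi⟩
    rcases Nat.eq_zero_or_pos i with rfl | h
    · simp at hx
    · exact h
  have hcard : (G.neighborSet u).ncard ≤ k := by
    refine (Set.ncard_le_ncard hsub (Set.toFinite _)).trans ?_
    refine (Set.ncard_image_le (Finset.finite_toSet _)).trans ?_
    rw [Set.ncard_coe_finset]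
    simp
  refine ⟨_, Walk.cons hk.2.symm (p.take k), ?_, ?_⟩
  · rw [Walk.cons_isCycle_iff]
    refine ⟨hp.take k, fun he => ?_⟩
    have h1 := (hp.take k).eq_snd_of_mem_edges (Sym2.eq_swap ▸ he)
    have h2 : p.getVert k = p.getVert 1 := by
      rw [h1, Walk.snd, Walk.take_getVert]
      congr 1
      omega
    have h3 : k = 1 := hp.getVert_injOn (by simp; omega) (by simp; omega) h2
    omega
  · rw [Walk.length_cons, Walk.take_length]
    omega

/-- A subgraph `F` of a `2`-edge-connected graph `G` extends to a `2`-edge-connected graph that has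
few edges, in terms of the non-neighbours of the vertices of some class of `F`. -/
theorem exists_isEdgeConnected_two_extension [Finite V] [Nonempty V] (hG : G.IsEdgeConnected 2)
    (hHG : H ≤ G) :
    ∃ w₀, ∀ w, H.IsEdgeReachable 2 w₀ w → ∃ K, H ≤ K ∧ K ≤ G ∧ K.IsEdgeConnected 2 ∧
      K.edgeSet.ncard ≤ H.edgeSet.ncard + Nat.card (Quotient H.twoEdgeSetoid) +
        {y | ¬ H.IsEdgeReachable 2 w y ∧ ¬ G.Adj w y}.ncard := by
  classical
  have : Nonempty (Quotient H.twoEdgeSetoid) := ⟨Quotient.mk _ (Classical.arbitrary V)⟩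
  obtain ⟨b, hb⟩ := exists_vertex_cycle_length_gt (classGraph G H)
  obtain ⟨w₀, rfl⟩ := Quotient.exists_rep b
  refine ⟨w₀, fun w hw => ?_⟩
  rw [show (⟦w₀⟧ : Quotient H.twoEdgeSetoid) = Quotient.mk _ w from
    twoEdgeSetoid_mk_eq.2 hw] at hb
  set N := (classGraph G H).neighborSet (Quotient.mk _ w) with hN
  set Y := {y | ¬ H.IsEdgeReachable 2 w y ∧ ¬ G.Adj w y} with hY
  have hp : Nat.card (Quotient H.twoEdgeSetoid) ≤ 1 + N.ncard + Y.ncard := by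
    have h1 : (Set.univ : Set (Quotient H.twoEdgeSetoid)) ⊆
        ({Quotient.mk _ w} ∪ N) ∪ Quotient.mk _ '' Y := by
      intro c _
      induction c using Quotient.inductionOn with
      | h y =>
        by_cases h1 : H.IsEdgeReachable 2 w y
        · exact Or.inl (Or.inl (twoEdgeSetoid_mk_eq.2 h1.symm))
        · by_cases h2 : G.Adj w y
          · exact Or.inl (Or.inr ⟨fun h => h1 (twoEdgeSetoid_mk_eq.1 h), w, y, rfl, rfl, h2⟩)
          · exact Or.inr ⟨y, ⟨h1, h2⟩, rfl⟩
    rw [← Set.ncard_univ]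
    refine (Set.ncard_le_ncard h1 (Set.toFinite _)).trans ((Set.ncard_union_le _ _).trans ?_)
    refine Nat.add_le_add ((Set.ncard_union_le _ _).trans ?_) (Set.ncard_image_le (Set.toFinite _))
    rw [Set.ncard_singleton]
  -- Let `p` be the number of classes and `d = N.ncard`. If `d ≤ 1`, the bound `2 * p - 2` suffices
  -- by `hp`. Otherwise the cycle of length `ℓ ≥ d + 1` is merged first, for a total of at most `2 *
  -- p - ℓ` new edges, which `hp` bounds by `p + Y.ncard`.
  rcases hb with hb | ⟨a, c, hc, hb⟩
  · obtain ⟨K, h1, h2, h3, h4⟩ := exists_isEdgeConnected_two_between hG hHG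
    exact ⟨K, h1, h2, h3, by omega⟩
  · obtain ⟨K, hHK, hKG, hcard, hmerge⟩ := exists_merge_cycle hHG c hc
    have hlen : c.length ≤ c.support.toFinset.card := by
      rw [← Nat.add_sub_cancel (n := c.length) (m := 1), ← c.length_support, ← List.length_tail,
        ← List.toFinset_card_of_nodup hc.support_nodup]
      exact Finset.card_le_card fun z hz => by
        rw [List.mem_toFinset] at hz ⊢
        exact List.mem_of_mem_tail hz
    have := card_classes_add_le hHK c.support.toFinset
      (fun x y hx hy => hmerge x y (by simpa using hx) (by simpa using hy))
      ⟨a, by simp⟩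
    obtain ⟨K', h1, h2, h3, h4⟩ := exists_isEdgeConnected_two_between hG hKG
    exact ⟨K', hHK.trans h1, h2, h3, by omega⟩

end TwoEdgeClasses

end SimpleGraph


/-! ### Colour families and the counting of edge excess -/

namespace SimpleGraph

section ColorFamilies

variable {V : Type*} {G K : SimpleGraph V}

theorem Reachable.mem_support_right {u v : V} (hu : u ∈ K.support) (h : K.Reachable u v) :
    v ∈ K.support := by
  obtain ⟨p⟩ := h
  induction p with
  | nil => exact hu
  | cons h p ih => exact ih ⟨_, h.symm⟩

theorem Reachable.mem_support_of_ne {u v : V} (h : K.Reachable u v) (hne : u ≠ v) :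
    u ∈ K.support := by
  obtain ⟨p⟩ := h
  cases p with
  | nil => exact absurd rfl hne
  | cons h p => exact ⟨_, h⟩

/-- A connected component with `m` edges has at most `m + 1` vertices. -/
theorem ncard_reachable_le [Finite V] (K : SimpleGraph V) (u : V) :
    {v | K.Reachable u v}.ncard ≤ K.edgeSet.ncard + 1 := by
  have h1 := (K.connectedComponentMk u).connected_toSimpleGraph.card_vert_le_card_edgeSet_add_one
  have h2 : Nat.card (K.connectedComponentMk u) = {v | K.Reachable u v}.ncard := by
    rw [← Nat.card_coe_set_eq]
    refine Nat.card_congr (Equiv.setCongr ?_)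
    ext v
    change K.connectedComponentMk v = K.connectedComponentMk u ↔ _
    rw [ConnectedComponent.eq, reachable_comm]
    rfl
  have h3 : Nat.card (K.connectedComponentMk u).toSimpleGraph.edgeSet ≤ K.edgeSet.ncard := by
    rw [← Nat.card_coe_set_eq]
    exact Nat.card_le_card_of_injective
      (Embedding.mapEdgeSet (Embedding.induce (K.connectedComponentMk u).supp))
      (Embedding.mapEdgeSet _).injective
  omega

/-- Some edge at `u` is not a bridge. Deleting it leaves the component of `u` intact with one edge
fewer, which improves the tree bound by one. -/
theorem ncard_reachable_le_of_isEdgeReachable_two [Finite V] {u y : V} (hne : u ≠ y)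
    (h : K.IsEdgeReachable 2 u y) : {v | K.Reachable u v}.ncard ≤ K.edgeSet.ncard := by
  obtain ⟨w, hw, hw2⟩ := exists_adj_isEdgeReachable_two hne h
  have hr := isEdgeReachable_two.1 hw2 s(u, w)
  have hsub : {v | K.Reachable u v} ⊆ {v | (K.deleteEdges {s(u, w)}).Reachable u v} := by
    rintro v ⟨p⟩
    have key : ∀ {a b : V}, K.Walk a b → (K.deleteEdges {s(u, w)}).Reachable a b := by
      intro a b p
      induction p with
      | nil => rfl
      | @cons a c b h p ih =>
        refine Reachable.trans ?_ ih
        by_cases hac : s(a, c) = s(u, w)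
        · rcases Sym2.eq_iff.1 hac with ⟨rfl, rfl⟩ | ⟨rfl, rfl⟩
          · exact hr
          · exact hr.symm
        · exact Adj.reachable (deleteEdges_adj.2 ⟨h, hac⟩)
    exact key p
  have h1 := (Set.ncard_le_ncard hsub (Set.toFinite _)).trans (ncard_reachable_le _ u)
  rw [edgeSet_deleteEdges] at h1
  have h2 : s(u, w) ∈ K.edgeSet := hw
  have := Set.ncard_sdiff_singleton_add_one h2 (Set.toFinite _)
  omega

/-- A family of edge-disjoint connected nonempty subgraphs of `G` such that any two vertices are
`2`-edge-reachable in one of them or connected in two of them. -/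
structure IsColorFamily (G : SimpleGraph V) {ι : Type*} (C : ι → SimpleGraph V) : Prop where
  le : ∀ i, C i ≤ G
  eq_of_adj : ∀ {i j u v}, (C i).Adj u v → (C j).Adj u v → i = j
  ne_bot : ∀ i, C i ≠ ⊥
  reachable : ∀ {i u v}, u ∈ (C i).support → v ∈ (C i).support → (C i).Reachable u v
  cover : ∀ {u v}, u ≠ v → (∃ i, (C i).IsEdgeReachable 2 u v) ∨
    ∃ i j, i ≠ j ∧ (C i).Reachable u v ∧ (C j).Reachable u v

open scoped Classical in
/-- The vertices of a graph that are not isolated, as a finset. -/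
noncomputable def suppFinset [Fintype V] (K : SimpleGraph V) : Finset V :=
  Finset.univ.filter (· ∈ K.support)

/-- The number of edges minus one. -/
noncomputable def edgeExcess (K : SimpleGraph V) : ℕ := K.edgeSet.ncard - 1

theorem mem_suppFinset [Fintype V] {v : V} : v ∈ K.suppFinset ↔ v ∈ K.support := by
  simp [suppFinset]

theorem Reachable.mem_suppFinset [Fintype V] {u v : V} (h : K.Reachable u v) (hne : u ≠ v) :
    u ∈ K.suppFinset ∧ v ∈ K.suppFinset := by
  rw [SimpleGraph.mem_suppFinset, SimpleGraph.mem_suppFinset]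
  exact ⟨h.mem_support_of_ne hne, h.symm.mem_support_of_ne hne.symm⟩

namespace IsColorFamily

open scoped Classical

variable [Fintype V] {ι : Type*} {C : ι → SimpleGraph V}

theorem edgeExcess_add_one (h : IsColorFamily G C) (i : ι) :
    (C i).edgeExcess + 1 = (C i).edgeSet.ncard := by
  have : 0 < (C i).edgeSet.ncard := by
    rw [Set.ncard_pos (Set.toFinite _)]
    exact edgeSet_nonempty.2 (h.ne_bot i)
  unfold edgeExcess
  omega

theorem card_suppFinset_eq (h : IsColorFamily G C) {i : ι} {u : V}
    (hu : u ∈ (C i).suppFinset) :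
    (C i).suppFinset.card = {v | (C i).Reachable u v}.ncard := by
  rw [← Set.ncard_coe_finset]
  congr 1
  ext v
  rw [mem_suppFinset] at hu
  simp only [Finset.mem_coe, mem_suppFinset, Set.mem_ofPred_eq]
  exact ⟨h.reachable hu, Reachable.mem_support_right hu⟩

theorem card_suppFinset_le (h : IsColorFamily G C) {i : ι} {u : V}
    (hu : u ∈ (C i).suppFinset) : (C i).suppFinset.card ≤ (C i).edgeExcess + 2 := by
  rw [h.card_suppFinset_eq hu]
  have := h.edgeExcess_add_one i
  have := ncard_reachable_le (C i) u
  omega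

theorem card_suppFinset_le_of_isEdgeReachable_two (h : IsColorFamily G C) {i : ι} {u y : V}
    (hne : u ≠ y) (h2 : (C i).IsEdgeReachable 2 u y) :
    (C i).suppFinset.card ≤ (C i).edgeExcess + 1 := by
  rw [h.card_suppFinset_eq ((h2.reachable (by simp)).mem_suppFinset hne).1]
  have := h.edgeExcess_add_one i
  have := ncard_reachable_le_of_isEdgeReachable_two hne h2
  omega

theorem exists_mem_suppFinset (h : IsColorFamily G C) {u v : V} (hne : u ≠ v) :
    ∃ i, u ∈ (C i).suppFinset ∧ v ∈ (C i).suppFinset := by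
  rcases h.cover hne with ⟨i, hi⟩ | ⟨i, j, -, hi, -⟩
  · exact ⟨i, (hi.reachable (by simp)).mem_suppFinset hne⟩
  · exact ⟨i, hi.mem_suppFinset hne⟩

/-- If `v` is a neighbour of `u` in the colour `i`, a colour that is a tree around `u`, then another
colour joins `u` and `v`. -/
theorem exists_ne_mem_suppFinset (h : IsColorFamily G C) {i : ι} {u v : V} (hne : u ≠ v)
    (hi : ¬ (C i).IsEdgeReachable 2 u v) :
    ∃ j, j ≠ i ∧ u ∈ (C j).suppFinset ∧ v ∈ (C j).suppFinset := by
  rcases h.cover hne with ⟨j, hj⟩ | ⟨j, k, hjk, hj, hk⟩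
  · exact ⟨j, fun hji => hi (hji ▸ hj), (hj.reachable (by simp)).mem_suppFinset hne⟩
  · by_cases hji : j = i
    · exact ⟨k, fun hki => hjk (hji.trans hki.symm), hk.mem_suppFinset hne⟩
    · exact ⟨j, hji, hj.mem_suppFinset hne⟩

variable [Fintype ι]

/-- The colours that join `u` to `S` have total edge excess at least `|S|`. -/
theorem card_le_sum_edgeExcess (h : IsColorFamily G C) {u : V} {S : Finset V} (hu : u ∉ S) :
    S.card ≤ ∑ i with u ∈ (C i).suppFinset ∧ ∃ y ∈ S, y ∈ (C i).suppFinset,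
      (C i).edgeExcess := by
  set F := Finset.univ.filter
    (fun i => u ∈ (C i).suppFinset ∧ ∃ y ∈ S, y ∈ (C i).suppFinset) with hF
  have hFmem : ∀ {i y}, y ∈ S → u ∈ (C i).suppFinset → y ∈ (C i).suppFinset → i ∈ F := by
    intro i y hy hui hyi
    exact Finset.mem_filter.2 ⟨Finset.mem_univ _, hui, y, hy, hyi⟩
  set f : ι → ℕ := fun i => (S.filter (· ∈ (C i).suppFinset)).card with hf
  have hsub : ∀ i ∈ F, insert u (S.filter (· ∈ (C i).suppFinset)) ⊆ (C i).suppFinset := by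
    intro i hi x hx
    rw [Finset.mem_insert, Finset.mem_filter] at hx
    rcases hx with rfl | hx
    · exact (Finset.mem_filter.1 hi).2.1
    · exact hx.2
  have hfle : ∀ i ∈ F, f i + 1 ≤ (C i).suppFinset.card := by
    intro i hi
    have := Finset.card_le_card (hsub i hi)
    rwa [Finset.card_insert_of_notMem (by simp [hu])] at this
  -- The bad colours are those whose excess falls short of `f i`; they are trees with support
  -- exactly `u` and the part of `S` they meet. Each is charged to a neighbour of `u` in `S`. Since
  -- such a colour is a tree, another colour must also join that neighbour to `u`, and this extra
  -- incidence repays the deficit of one.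
  set Bd := F.filter (fun i => (C i).edgeExcess < f i) with hBd
  have hnb : ∀ i ∈ Bd, ∃ v ∈ S, (C i).Adj u v := by
    intro i hi
    obtain ⟨hiF, hbad⟩ := Finset.mem_filter.1 hi
    have hui := (Finset.mem_filter.1 hiF).2.1
    obtain ⟨v, hv⟩ := mem_suppFinset.1 hui
    refine ⟨v, ?_, hv⟩
    by_contra hvS
    have h1 : insert v (insert u (S.filter (· ∈ (C i).suppFinset))) ⊆ (C i).suppFinset := by
      rw [Finset.insert_subset_iff]
      exact ⟨mem_suppFinset.2 ⟨u, hv.symm⟩, hsub i hiF⟩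
    have h2 := Finset.card_le_card h1
    rw [Finset.card_insert_of_notMem (by simp [hvS, hv.ne']),
      Finset.card_insert_of_notMem (by simp [hu])] at h2
    have := h.card_suppFinset_le hui
    simp only [hf] at hbad
    omega
  have : Nonempty V := ⟨u⟩
  choose! nb hnbS hnbadj using hnb
  have hinj : Set.InjOn nb Bd := by
    intro i hi j hj hij
    exact h.eq_of_adj (hnbadj i hi) (hij ▸ hnbadj j hj)
  have hmult : ∀ y ∈ S, 1 + (if y ∈ Bd.image nb then 1 else 0) ≤
      (F.filter (fun i => y ∈ (C i).suppFinset)).card := by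
    intro y hy
    have hne : u ≠ y := fun huy => hu (huy ▸ hy)
    split_ifs with hyT
    · obtain ⟨i, hi, rfl⟩ := Finset.mem_image.1 hyT
      obtain ⟨hiF, hbad⟩ := Finset.mem_filter.1 hi
      have hadj := hnbadj i hi
      obtain ⟨j, hji, huj, hyj⟩ := h.exists_ne_mem_suppFinset (i := i) hne (fun h2 => by
        have h3 := h.card_suppFinset_le_of_isEdgeReachable_two hne h2
        have h4 := hfle i hiF
        omega)
      refine Finset.one_lt_card.2 ⟨j, ?_, i, ?_, hji⟩
      · exact Finset.mem_filter.2 ⟨hFmem hy huj hyj, hyj⟩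
      · exact Finset.mem_filter.2 ⟨hiF, mem_suppFinset.2 ⟨u, hadj.symm⟩⟩
    · obtain ⟨i, hui, hyi⟩ := h.exists_mem_suppFinset hne
      exact Finset.card_pos.2 ⟨i, Finset.mem_filter.2 ⟨hFmem hy hui hyi, hyi⟩⟩
  have hcount : ∑ y ∈ S, (F.filter (fun i => y ∈ (C i).suppFinset)).card = ∑ i ∈ F, f i := by
    simp only [hf, Finset.card_filter]
    exact Finset.sum_comm
  have h1 : S.card + Bd.card ≤ ∑ i ∈ F, f i := by
    rw [← hcount]
    refine le_trans ?_ (Finset.sum_le_sum hmult)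
    rw [Finset.sum_add_distrib, Finset.sum_boole, ← Finset.card_image_of_injOn hinj]
    simp only [Finset.sum_const, smul_eq_mul, mul_one, Nat.cast_id]
    gcongr
    intro y hy
    refine Finset.mem_filter.2 ⟨?_, hy⟩
    obtain ⟨i, hi, rfl⟩ := Finset.mem_image.1 hy
    exact hnbS i hi
  have h2 : ∑ i ∈ F, f i ≤ ∑ i ∈ F, (C i).edgeExcess + Bd.card := by
    rw [hBd, Finset.card_filter, ← Finset.sum_add_distrib]
    refine Finset.sum_le_sum fun i hi => ?_
    have h3 := hfle i hi
    have h4 := h.card_suppFinset_le (Finset.mem_filter.1 hi).2.1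
    split_ifs <;> omega
  omega

/-- If no colour is spanning, the colours that avoid `w` have large total edge excess in terms of
the vertices that a single colour joins to `w`. -/
theorem card_le_sum_edgeExcess_avoiding (h : IsColorFamily G C) {w : V} {R : Finset V} {c : V → ι}
    (hc : ∀ y ∈ R, y ∈ (C (c y)).suppFinset)
    (huniq : ∀ y ∈ R, ∀ i, w ∈ (C i).suppFinset → y ∈ (C i).suppFinset → i = c y)
    (hspan : ∀ i, ∃ v, v ∉ (C i).suppFinset) :
    R.card ≤ (∑ i with w ∉ (C i).suppFinset, (C i).edgeExcess) + 2 * (R.image c).card := by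
  set B := Finset.univ.filter (fun i => w ∉ (C i).suppFinset) with hB
  have hBmem : ∀ {i}, w ∉ (C i).suppFinset → i ∈ B := fun hi =>
    Finset.mem_filter.2 ⟨Finset.mem_univ _, hi⟩
  rcases Nat.lt_or_ge 1 (R.image c).card with hm | hm
  · have hJne : (R.image c).Nonempty := Finset.card_pos.1 (by omega)
    -- The fibres of `c` partition `R`; `P` is a smallest part.
    obtain ⟨j₁, hj₁, hmin⟩ := (R.image c).exists_min_image
      (fun j => (R.filter (fun y => c y = j)).card) hJne
    set P := R.filter (fun y => c y = j₁) with hP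
    have hPne : P.Nonempty := by
      obtain ⟨y, hy, hyj⟩ := Finset.mem_image.1 hj₁
      exact ⟨y, Finset.mem_filter.2 ⟨hy, hyj⟩⟩
    -- colours between different parts avoid `w`
    have hcross : ∀ {v y i}, v ∈ R → y ∈ R → c v ≠ c y → v ∈ (C i).suppFinset →
        y ∈ (C i).suppFinset → i ∈ B := by
      intro v y i hv hy hne hvi hyi
      refine hBmem fun hwi => hne ?_
      rw [← huniq v hv i hwi hvi, ← huniq y hy i hwi hyi]
    have hsplit : P.card + (R \ P).card = R.card := by
      rw [add_comm]
      exact Finset.card_sdiff_add_card_eq_card (Finset.filter_subset _ _)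
    -- A colour `i` avoiding `w` with more than `P.card` vertices of `R` nearly pays for `P`, or for
    -- the vertices of `R` that it contains. The remaining vertices are paid for by colours joining
    -- them to some `v ∈ P`, which also avoid `w` and differ from `i`. The loss of at most two is
    -- covered, as there are at least two parts.
    by_cases hbig : ∃ i ∈ B, P.card < (R.filter (· ∈ (C i).suppFinset)).card
    · obtain ⟨i, hiB, hi⟩ := hbig
      obtain ⟨z, hz⟩ : (R.filter (· ∈ (C i).suppFinset)).Nonempty :=
        Finset.card_pos.1 (by omega)
      have hsi := h.card_suppFinset_le (Finset.mem_filter.1 hz).2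
      have hRi : (R.filter (· ∈ (C i).suppFinset)).card ≤ (C i).suppFinset.card :=
        Finset.card_le_card fun y hy => (Finset.mem_filter.1 hy).2
      have haux : ∀ v ∈ P, ∀ S ⊆ R \ P, (v ∈ (C i).suppFinset → ∀ y ∈ S,
          y ∉ (C i).suppFinset) → (C i).edgeExcess + S.card ≤ ∑ i ∈ B, (C i).edgeExcess := by
        intro v hv S hS hvS
        have hvS' : v ∉ S := fun hvS => (Finset.mem_sdiff.1 (hS hvS)).2 hv
        have hloc := h.card_le_sum_edgeExcess hvS'
        set F := Finset.univ.filter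
          (fun i => v ∈ (C i).suppFinset ∧ ∃ y ∈ S, y ∈ (C i).suppFinset) with hF
        have hiF : i ∉ F := by
          intro hiF
          obtain ⟨hvi, y, hy, hyi⟩ := (Finset.mem_filter.1 hiF).2
          exact hvS hvi y hy hyi
        have hsub : insert i F ⊆ B := by
          rw [Finset.insert_subset_iff]
          refine ⟨hiB, fun k hk => ?_⟩
          obtain ⟨hvk, y, hy, hyk⟩ := (Finset.mem_filter.1 hk).2
          have hyR := Finset.mem_sdiff.1 (hS hy)
          have hvP := Finset.mem_filter.1 hv
          refine hcross hvP.1 hyR.1 (fun hvy => hyR.2 ?_) hvk hyk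
          exact Finset.mem_filter.2 ⟨hyR.1, hvy.symm.trans hvP.2⟩
        have := Finset.sum_le_sum_of_subset (f := fun i => (C i).edgeExcess) hsub
        rw [Finset.sum_insert hiF] at this
        omega
      by_cases hPi : ∃ v ∈ P, v ∉ (C i).suppFinset
      · obtain ⟨v, hv, hvi⟩ := hPi
        have := haux v hv (R \ P) le_rfl (fun hvi' => absurd hvi' hvi)
        omega
      · push Not at hPi
        obtain ⟨v, hv⟩ := hPne
        have := haux v hv ((R \ P).filter (· ∉ (C i).suppFinset)) (Finset.filter_subset _ _)
          (fun _ y hy => (Finset.mem_filter.1 hy).2)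
        have hle : R.card ≤ (R.filter (· ∈ (C i).suppFinset)).card +
            ((R \ P).filter (· ∉ (C i).suppFinset)).card := by
          rw [← Finset.card_filter_add_card_filter_not (s := R) (· ∈ (C i).suppFinset)]
          gcongr 1
          refine Finset.card_le_card fun y hy => ?_
          obtain ⟨hyR, hyi⟩ := Finset.mem_filter.1 hy
          exact Finset.mem_filter.2
            ⟨Finset.mem_sdiff.2 ⟨hyR, fun hyP => hyi (hPi y hyP)⟩, hyi⟩
        omega
    · push Not at hbig
      -- Without such a colour, every `v ∈ R` is joined to a part other than its own, of size at
      -- least `P.card`, by colours avoiding `w`. Summing over `v` counts each excess at most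
      -- `P.card` times, and the factor `P.card` cancels.
      have hlow : ∀ v ∈ R, P.card ≤ ∑ i ∈ B with v ∈ (C i).suppFinset, (C i).edgeExcess := by
        intro v hv
        obtain ⟨j, hj, hjv⟩ := Finset.exists_mem_ne hm (c v)
        have hS : v ∉ R.filter (fun y => c y = j) := fun hvj =>
          hjv (Finset.mem_filter.1 hvj).2.symm
        refine (hmin j hj).trans ((h.card_le_sum_edgeExcess hS).trans
          (Finset.sum_le_sum_of_subset fun i hi => ?_))
        obtain ⟨hvi, y, hy, hyi⟩ := (Finset.mem_filter.1 hi).2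
        obtain ⟨hyR, hyj⟩ := Finset.mem_filter.1 hy
        exact Finset.mem_filter.2
          ⟨hcross hv hyR (fun hvy => hjv (hyj.symm.trans hvy.symm)) hvi hyi, hvi⟩
      have hsum := Finset.sum_le_sum hlow
      rw [Finset.sum_const, smul_eq_mul] at hsum
      have hswap : ∑ v ∈ R, ∑ i ∈ B with v ∈ (C i).suppFinset, (C i).edgeExcess =
          ∑ i ∈ B, (C i).edgeExcess * (R.filter (· ∈ (C i).suppFinset)).card := by
        simp only [Finset.sum_filter, Finset.card_filter, Finset.mul_sum, mul_ite, mul_one,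
          mul_zero]
        exact Finset.sum_comm
      have hle : ∑ i ∈ B, (C i).edgeExcess * (R.filter (· ∈ (C i).suppFinset)).card ≤
          (∑ i ∈ B, (C i).edgeExcess) * P.card := by
        rw [Finset.sum_mul]
        exact Finset.sum_le_sum fun i hi => Nat.mul_le_mul_left _ (hbig i hi)
      have hfin := hsum.trans (hswap.le.trans hle)
      have := Nat.le_of_mul_le_mul_right hfin (Finset.card_pos.2 hPne)
      omega
  · rcases R.eq_empty_or_nonempty with rfl | ⟨y₀, hy₀⟩
    · simp
    · have hconst : ∀ y ∈ R, c y = c y₀ := fun y hy =>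
        Finset.card_le_one.1 hm _ (Finset.mem_image_of_mem c hy) _ (Finset.mem_image_of_mem c hy₀)
      -- With a single part, a vertex `v` missed by its colour is joined to `R` only by colours
      -- avoiding `w`: a colour through `w` and a vertex of `R` would be `c y₀`.
      obtain ⟨v, hv⟩ := hspan (c y₀)
      have hvR : v ∉ R := fun hvR => hv (hconst v hvR ▸ hc v hvR)
      have hloc := h.card_le_sum_edgeExcess hvR
      have hle : ∑ i with v ∈ (C i).suppFinset ∧ ∃ y ∈ R, y ∈ (C i).suppFinset,
          (C i).edgeExcess ≤ ∑ i ∈ B, (C i).edgeExcess := by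
        refine Finset.sum_le_sum_of_subset fun i hi => hBmem fun hwi => ?_
        obtain ⟨hvi, y, hy, hyi⟩ := (Finset.mem_filter.1 hi).2
        rw [huniq y hy i hwi hyi, hconst y hy] at hvi
        exact hv hvi
      omega

/-- The case of `exists_spanning_isEdgeConnected_two` in which some colour is spanning. -/
theorem exists_spanning_of_suppFinset_eq_univ [Nonempty V] (h : IsColorFamily G C)
    (hG : G.IsEdgeConnected 2) {i₀ : ι} (hi₀ : ∀ v, v ∈ (C i₀).suppFinset) :
    ∃ H ≤ G, H.IsEdgeConnected 2 ∧ H.edgeSet.ncard ≤ 1 + ∑ i, (C i).edgeExcess := by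
  set K := C i₀ with hK
  have hKx : K.edgeExcess + 1 = K.edgeSet.ncard := h.edgeExcess_add_one i₀
  have hsumK : ∑ i, (C i).edgeExcess =
      K.edgeExcess + ∑ i ∈ Finset.univ.erase i₀, (C i).edgeExcess :=
    (Finset.add_sum_erase _ (fun i => (C i).edgeExcess) (Finset.mem_univ i₀)).symm
  have hKconn : ∀ u v, K.Reachable u v := fun u v =>
    h.reachable (mem_suppFinset.1 (hi₀ u)) (mem_suppFinset.1 (hi₀ v))
  by_cases hK2 : K.IsEdgeConnected 2
  · exact ⟨K, h.le i₀, hK2, by omega⟩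
  -- `F` consists of the non-bridge edges of `K` and has the same 2-edge-reachability classes,
  -- because a trail between 2-edge-reachable vertices never leaves their class.
  let F : SimpleGraph V :=
    { Adj u v := K.Adj u v ∧ K.IsEdgeReachable 2 u v
      symm := ⟨fun _ _ huv => ⟨huv.1.symm, huv.2.symm⟩⟩
      loopless := ⟨fun _ huv => huv.1.ne rfl⟩ }
  have hFK : F ≤ K := fun _ _ huv => huv.1
  have hFiff : ∀ u v, F.IsEdgeReachable 2 u v ↔ K.IsEdgeReachable 2 u v := by
    refine fun u v => ⟨fun huv => huv.mono hFK, fun huv => isEdgeReachable_two.2 fun e => ?_⟩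
    obtain ⟨p, hp⟩ := (isEdgeReachable_two.1 huv e).exists_isPath
    have hle : K.deleteEdges {e} ≤ K := deleteEdges_le _
    have hpe : ∀ f ∈ p.edges, f ∈ (F.deleteEdges {e}).edgeSet := by
      intro f
      induction f with
      | h a b =>
        intro hf
        have hab : (K.deleteEdges {e}).Adj a b := p.adj_of_mem_edges hf
        rw [deleteEdges_adj] at hab
        have h2 := (hp.isTrail.mapLe hle).isEdgeReachable_two_of_isEdgeReachable_two huv
          (x := a) (y := b) (by simpa using p.fst_mem_support_of_mem_edges hf)
          (by simpa using p.snd_mem_support_of_mem_edges hf)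
        exact deleteEdges_adj.2 ⟨⟨hab.1, h2⟩, hab.2⟩
    exact ⟨p.transfer _ hpe⟩
  -- The bridges of `K` connect the classes of `F`, so there are at least as many bridges as classes
  -- minus one.
  have hcount : F.edgeSet.ncard + Nat.card (Quotient F.twoEdgeSetoid) ≤ K.edgeSet.ncard + 1 := by
    have hne : Nonempty (Quotient F.twoEdgeSetoid) := ⟨Quotient.mk _ (Classical.arbitrary V)⟩
    have hconn : (classGraph K F).Connected := by
      refine ⟨fun a b => ?_⟩
      induction a using Quotient.inductionOn with
      | h x =>
        induction b using Quotient.inductionOn with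
        | h y =>
          obtain ⟨p⟩ := hKconn x y
          induction p with
          | nil => rfl
          | @cons x z y hxz p ih =>
            refine Reachable.trans ?_ ih
            by_cases hq : Quotient.mk F.twoEdgeSetoid x = Quotient.mk F.twoEdgeSetoid z
            · rw [hq]
            · exact Adj.reachable ⟨hq, x, z, rfl, rfl, hxz⟩
    have h1 := hconn.card_vert_le_card_edgeSet_add_one
    rw [Nat.card_coe_set_eq] at h1
    have h2 : (classGraph K F).edgeSet ⊆
        Sym2.map (Quotient.mk F.twoEdgeSetoid) '' (K.edgeSet \ F.edgeSet) := by
      intro q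
      induction q with
      | h a b =>
        rintro ⟨hne, u, v, rfl, rfl, huv⟩
        refine ⟨s(u, v), ⟨huv, fun hF => hne ?_⟩, rfl⟩
        exact twoEdgeSetoid_mk_eq.2 ((hFiff u v).2 hF.2)
    have h3 := (Set.ncard_le_ncard h2 (Set.toFinite _)).trans (Set.ncard_image_le (Set.toFinite _))
    have h4 := Set.ncard_sdiff_add_ncard_of_subset (edgeSet_subset_edgeSet.2 hFK)
      (Set.toFinite _)
    omega
  obtain ⟨w₀, hw₀⟩ := exists_isEdgeConnected_two_extension hG (hFK.trans (h.le i₀))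
  -- The freedom to choose `w` within the class of `w₀` is used to make `w` an end of a bridge of
  -- `K`. Its other end `y₀` enlarges `Y` by one, which yields exactly the edge still to be saved.
  obtain ⟨w, y₀, hw, hwy, hy₀⟩ : ∃ w y₀, K.IsEdgeReachable 2 w₀ w ∧ K.Adj w y₀ ∧
      ¬ K.IsEdgeReachable 2 w y₀ := by
    by_contra! hcon
    have key : ∀ {a b}, K.Walk a b → K.IsEdgeReachable 2 w₀ a → K.IsEdgeReachable 2 w₀ b := by
      intro a b p
      induction p with
      | nil => exact id
      | cons hadj p ih => exact fun ha => ih (ha.trans (hcon _ _ ha hadj))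
    have key' : ∀ v, K.IsEdgeReachable 2 w₀ v := fun v =>
      (hKconn w₀ v).elim fun p => key p .rfl
    exact hK2 fun u v => (key' u).symm.trans (key' v)
  obtain ⟨H, -, hHG, hH2, hHcard⟩ := hw₀ w ((hFiff _ _).2 hw)
  refine ⟨H, hHG, hH2, ?_⟩
  set Y := {y | ¬ F.IsEdgeReachable 2 w y ∧ ¬ G.Adj w y} with hY
  have hy₀Y : y₀ ∉ Y := fun hy => hy.2 (h.le i₀ hwy)
  set S := insert y₀ Y.toFinset with hS
  have hScard : S.card = Y.ncard + 1 := by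
    rw [hS, Finset.card_insert_of_notMem (by simpa using hy₀Y), Set.ncard_eq_toFinset_card']
  have hSnot : ∀ y ∈ S, ¬ K.IsEdgeReachable 2 w y := by
    intro y hy
    rw [hS, Finset.mem_insert, Set.mem_toFinset] at hy
    rcases hy with rfl | hy
    · exact hy₀
    · exact fun h2 => hy.1 ((hFiff _ _).2 h2)
  have hwS : w ∉ S := fun hw => hSnot w hw .rfl
  have hSle : S.card ≤ ∑ i ∈ Finset.univ.erase i₀, (C i).edgeExcess := by
    set T := (Finset.univ.erase i₀).filter
      (fun i => w ∈ (C i).suppFinset ∧ ∃ y ∈ S, y ∈ (C i).suppFinset) with hT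
    have hcov : S ⊆ T.biUnion fun i => S.filter (· ∈ (C i).suppFinset) := by
      intro y hy
      obtain ⟨i, hi, hwi, hyi⟩ := h.exists_ne_mem_suppFinset (u := w) (v := y)
        (fun hwy => hwS (hwy ▸ hy)) (hSnot y hy)
      rw [Finset.mem_biUnion]
      exact ⟨i, Finset.mem_filter.2 ⟨Finset.mem_erase.2 ⟨hi, Finset.mem_univ _⟩, hwi, y, hy, hyi⟩,
        Finset.mem_filter.2 ⟨hy, hyi⟩⟩
    refine (Finset.card_le_card hcov).trans (Finset.card_biUnion_le.trans
      ((Finset.sum_le_sum fun i hi => ?_).trans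
        (Finset.sum_le_sum_of_subset (Finset.filter_subset _ _))))
    obtain ⟨hie, hwi, -⟩ := Finset.mem_filter.1 hi
    -- A neighbour `v` of `w` in a colour other than `i₀` is outside `S`: it is adjacent to `w` in
    -- `G`, and the edge from `w` to `y₀` has colour `i₀`. So the support of `i` has two vertices
    -- outside `S`, and its excess covers the vertices of `S` in it.
    obtain ⟨v, hv⟩ := mem_suppFinset.1 hwi
    have hvS : v ∉ S := by
      rw [hS, Finset.mem_insert, Set.mem_toFinset]
      rintro (rfl | hvY)
      · exact (Finset.mem_erase.1 hie).1 (h.eq_of_adj hv hwy)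
      · exact hvY.2 (h.le i hv)
    have hsub : insert v (insert w (S.filter (· ∈ (C i).suppFinset))) ⊆ (C i).suppFinset := by
      rw [Finset.insert_subset_iff, Finset.insert_subset_iff]
      exact ⟨mem_suppFinset.2 ⟨w, hv.symm⟩, hwi, fun y hy => (Finset.mem_filter.1 hy).2⟩
    have hc := Finset.card_le_card hsub
    rw [Finset.card_insert_of_notMem (by simp [hvS, hv.ne']),
      Finset.card_insert_of_notMem (by simp [hwS])] at hc
    have := h.card_suppFinset_le hwi
    omega
  omega

/-- The case of `exists_spanning_isEdgeConnected_two` in which no colour is spanning. -/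
theorem exists_spanning_of_forall_exists_notMem [Nonempty V] (h : IsColorFamily G C)
    (hG : G.IsEdgeConnected 2) (hspan : ∀ i, ∃ v, v ∉ (C i).suppFinset) :
    ∃ H ≤ G, H.IsEdgeConnected 2 ∧ H.edgeSet.ncard ≤ 1 + ∑ i, (C i).edgeExcess := by
  obtain ⟨w, hw⟩ := exists_isEdgeConnected_two_extension hG (bot_le (a := G))
  obtain ⟨H, -, hHG, hH2, hHcard⟩ := hw w .rfl
  refine ⟨H, hHG, hH2, ?_⟩
  set N := Finset.univ.filter (fun y => G.Adj w y) with hN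
  have hn : 0 < Fintype.card V := Fintype.card_pos
  have hH : H.edgeSet.ncard + N.card + 1 ≤ 2 * Fintype.card V := by
    have h1 : Nat.card (Quotient (⊥ : SimpleGraph V).twoEdgeSetoid) ≤ Fintype.card V := by
      rw [← Nat.card_eq_fintype_card]
      exact Nat.card_le_card_of_surjective _ Quotient.mk_surjective
    have h2 : {y | ¬ (⊥ : SimpleGraph V).IsEdgeReachable 2 w y ∧ ¬ G.Adj w y} ⊆
        (((insert w N)ᶜ : Finset V) : Set V) := by
      rintro y ⟨hy, hy'⟩
      simp only [Finset.mem_coe, Finset.mem_compl, Finset.mem_insert, hN, Finset.mem_filter,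
        Finset.mem_univ, true_and, not_or]
      exact ⟨fun hyw => hy (hyw ▸ .rfl), hy'⟩
    have h3 := Set.ncard_le_ncard h2 (Set.toFinite _)
    rw [Set.ncard_coe_finset, Finset.card_compl, Finset.card_insert_of_notMem (by simp [hN])] at h3
    have h4 : N.card < Fintype.card V :=
      Finset.card_lt_univ_of_notMem (x := w) (by simp [hN])
    rw [edgeSet_bot, Set.ncard_empty] at hHcard
    omega
  set A := Finset.univ.filter (fun i => w ∈ (C i).suppFinset) with hA
  -- `I` collects the trees among the colours at `w`, and `R` the vertices joined to `w` by just one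
  -- colour. It remains to show that `2 * (n - 1)` is at most the total excess plus the degree of
  -- `w`.
  set I := A.filter (fun i => (C i).edgeExcess + 1 < (C i).suppFinset.card) with hI
  set mult : V → ℕ := fun y => (A.filter (fun i => y ∈ (C i).suppFinset)).card with hmult
  set R := (Finset.univ.erase w).filter (fun y => mult y = 1) with hR
  have hmult1 : ∀ y ∈ Finset.univ.erase w, 1 ≤ mult y := by
    intro y hy
    obtain ⟨i, hwi, hyi⟩ := h.exists_mem_suppFinset (Finset.ne_of_mem_erase hy).symm
    exact Finset.card_pos.2 ⟨i, by simp [hA, hwi, hyi]⟩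
  have hsumA : 2 * (Fintype.card V - 1) ≤ ∑ i ∈ A, (C i).edgeExcess + I.card + R.card := by
    have h1 : ∑ y ∈ Finset.univ.erase w, 2 ≤ ∑ y ∈ Finset.univ.erase w, mult y + R.card := by
      rw [hR, Finset.card_filter, ← Finset.sum_add_distrib]
      refine Finset.sum_le_sum fun y hy => ?_
      have := hmult1 y hy
      split_ifs <;> omega
    have h2 : ∑ y ∈ Finset.univ.erase w, mult y =
        ∑ i ∈ A, ((Finset.univ.erase w).filter (· ∈ (C i).suppFinset)).card := by
      simp only [hmult, Finset.card_filter]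
      exact Finset.sum_comm
    have h3 : ∑ i ∈ A, ((Finset.univ.erase w).filter (· ∈ (C i).suppFinset)).card ≤
        ∑ i ∈ A, (C i).edgeExcess + I.card := by
      rw [hI, Finset.card_filter, ← Finset.sum_add_distrib]
      refine Finset.sum_le_sum fun i hi => ?_
      have hwi := (Finset.mem_filter.1 hi).2
      have h4 : ((Finset.univ.erase w).filter (· ∈ (C i).suppFinset)) =
          (C i).suppFinset.erase w := by
        ext y
        simp [and_comm]
      rw [h4, Finset.card_erase_of_mem hwi]
      have := h.card_suppFinset_le hwi
      split_ifs <;> omega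
    rw [Finset.sum_const, Finset.card_erase_of_mem (Finset.mem_univ _), Finset.card_univ,
      smul_eq_mul] at h1
    omega
  have hc : ∀ y ∈ R, ∃ i, (C i).IsEdgeReachable 2 w y ∧
      ∀ k, w ∈ (C k).suppFinset → y ∈ (C k).suppFinset → k = i := by
    intro y hy
    obtain ⟨hyw, hy1⟩ := Finset.mem_filter.1 hy
    have hne := (Finset.ne_of_mem_erase hyw).symm
    have huniq : ∀ i k, w ∈ (C i).suppFinset → y ∈ (C i).suppFinset → w ∈ (C k).suppFinset →
        y ∈ (C k).suppFinset → k = i := by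
      intro i k hwi hyi hwk hyk
      exact Finset.card_le_one.1 hy1.le k (by simp [hA, hwk, hyk]) i (by simp [hA, hwi, hyi])
    rcases h.cover hne with ⟨i, hi⟩ | ⟨i, k, hik, hi, hk⟩
    · have := (hi.reachable (by simp)).mem_suppFinset hne
      exact ⟨i, hi, fun k hwk hyk => huniq i k this.1 this.2 hwk hyk⟩
    · have h1 := hi.mem_suppFinset hne
      have h2 := hk.mem_suppFinset hne
      exact absurd (huniq k i h2.1 h2.2 h1.1 h1.2) hik
  -- Without colours, `hsumA` leaves a single vertex. The case is split off because `choose!` needs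
  -- a default colour.
  rcases isEmpty_or_nonempty ι with hι | hι
  · have hA0 : A = ∅ := Finset.eq_empty_of_isEmpty A
    have hI0 : I = ∅ := Finset.eq_empty_of_isEmpty I
    have hR0 : R = ∅ := by
      refine Finset.eq_empty_of_forall_notMem fun y hy => ?_
      obtain ⟨i, -⟩ := hc y hy
      exact hι.elim i
    rw [hA0, hI0, hR0] at hsumA
    simp only [Finset.sum_empty, Finset.card_empty] at hsumA
    omega
  choose! c hc2 hcu using hc
  -- At `w`, a tree colour has at least one edge, and a colour in the image of `c` at least two
  -- because `w` is 2-edge-reachable there from another vertex. These colours are distinct and their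
  -- edges disjoint.
  have hdeg : I.card + 2 * (R.image c).card ≤ N.card := by
    have hdisj : Disjoint I (R.image c) := by
      rw [Finset.disjoint_left]
      rintro i hi hiR
      obtain ⟨y, hy, rfl⟩ := Finset.mem_image.1 hiR
      have hne := (Finset.ne_of_mem_erase (Finset.mem_filter.1 hy).1).symm
      have := h.card_suppFinset_le_of_isEdgeReachable_two hne (hc2 y hy)
      have := (Finset.mem_filter.1 hi).2
      omega
    have hpd : ((I ∪ R.image c : Finset ι) : Set ι).PairwiseDisjoint
        fun i => (C i).neighborFinset w := by
      intro i _ j _ hij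
      rw [Function.onFun, Finset.disjoint_left]
      intro v hv hv'
      rw [mem_neighborFinset] at hv hv'
      exact hij (h.eq_of_adj hv hv')
    have hsub : (I ∪ R.image c).biUnion (fun i => (C i).neighborFinset w) ⊆ N := by
      intro v hv
      obtain ⟨i, -, hv⟩ := Finset.mem_biUnion.1 hv
      rw [mem_neighborFinset] at hv
      exact Finset.mem_filter.2 ⟨Finset.mem_univ _, h.le i hv⟩
    have h1 := Finset.card_le_card hsub
    rw [Finset.card_biUnion hpd, Finset.sum_union hdisj] at h1
    have h2 : ∑ i ∈ I, 1 ≤ ∑ i ∈ I, ((C i).neighborFinset w).card := by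
      refine Finset.sum_le_sum fun i hi => ?_
      obtain ⟨v, hv⟩ := mem_suppFinset.1
        (Finset.mem_filter.1 (Finset.mem_filter.1 hi).1).2
      exact Finset.card_pos.2 ⟨v, (mem_neighborFinset _ _ _).2 hv⟩
    have h3 : ∑ i ∈ R.image c, 2 ≤ ∑ i ∈ R.image c, ((C i).neighborFinset w).card := by
      refine Finset.sum_le_sum fun i hi => ?_
      obtain ⟨y, hy, rfl⟩ := Finset.mem_image.1 hi
      have hne := (Finset.ne_of_mem_erase (Finset.mem_filter.1 hy).1).symm
      exact (hc2 y hy).le_degree hne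
    simp only [Finset.sum_const, smul_eq_mul] at h2 h3
    omega
  have havoid := h.card_le_sum_edgeExcess_avoiding (w := w) (R := R) (c := c)
    (fun y hy => (((hc2 y hy).reachable (by simp)).mem_suppFinset
      (Finset.ne_of_mem_erase (Finset.mem_filter.1 hy).1).symm).2) hcu hspan
  have hsplit : ∑ i, (C i).edgeExcess = ∑ i ∈ A, (C i).edgeExcess +
      ∑ i with w ∉ (C i).suppFinset, (C i).edgeExcess :=
    (Finset.sum_filter_add_sum_filter_not _ _ _).symm
  omega

/-- A `2`-edge-connected graph with a colour family has a `2`-edge-connected spanning subgraph with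
at most `1 + ∑ (e(C i) - 1)` edges. -/
theorem exists_spanning_isEdgeConnected_two [Nonempty V] (h : IsColorFamily G C)
    (hG : G.IsEdgeConnected 2) :
    ∃ H ≤ G, H.IsEdgeConnected 2 ∧ H.edgeSet.ncard ≤ 1 + ∑ i, (C i).edgeExcess := by
  by_cases hspan : ∃ i, ∀ v, v ∈ (C i).suppFinset
  · obtain ⟨i, hi⟩ := hspan
    exact h.exists_spanning_of_suppFinset_eq_univ hG hi
  · push Not at hspan
    exact h.exists_spanning_of_forall_exists_notMem hG hspan

end IsColorFamily

end ColorFamilies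

end SimpleGraph


/-! ### Edge-disjoint paths and the formula for `mc 2 G` -/

namespace SimpleGraph

section MonochromaticNumber

variable {V : Type*} {G H : SimpleGraph V}

theorem exists_disjoint_walks_of_takeUntil [DecidableEq V] {u w v z : V} (hwv : G.Adj w v)
    (p q : G.Walk u w) (hpq : p.edges.Disjoint q.edges) (hz : z ∈ p.support) (r : G.Walk z v)
    (hrq : r.edges.Disjoint q.edges) (hr : s(w, v) ∉ r.edges)
    (hp : s(w, v) ∉ (p.takeUntil z hz).edges) :
    ∃ p' q' : G.Walk u v, p'.edges.Disjoint q'.edges := by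
  refine ⟨(p.takeUntil z hz).append r, q.concat hwv, ?_⟩
  rw [Walk.edges_append, Walk.edges_concat, List.concat_eq_append]
  intro e he he'
  rw [List.mem_append] at he he'
  rw [List.mem_singleton] at he'
  rcases he with he | he <;> rcases he' with he' | rfl
  · exact hpq (p.edges_takeUntil_subset_edges hz he) he'
  · exact hp he
  · exact hrq he he'
  · exact hr he

/-- Induction step of the edge version of Menger's theorem for two paths: a disjoint pair ending at
`w` is rerouted to end at the neighbour `v`. -/
theorem exists_disjoint_walks_step {u w v : V} (hG : G.IsEdgeConnected 2) (hwv : G.Adj w v)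
    (h : ∃ p q : G.Walk u w, p.edges.Disjoint q.edges) :
    ∃ p q : G.Walk u v, p.edges.Disjoint q.edges := by
  classical
  obtain ⟨p, q, hp, hq, hpq⟩ : ∃ p q : G.Walk u w, p.IsPath ∧ q.IsPath ∧
      p.edges.Disjoint q.edges := by
    obtain ⟨p, q, hpq⟩ := h
    exact ⟨p.bypass, q.bypass, p.bypass_isPath, q.bypass_isPath, fun e he he' =>
      hpq (p.edges_bypass_subset_edges he) (q.edges_bypass_subset_edges he')⟩
  have hnot : ∀ p : G.Walk u w, p.IsPath → ∀ hv : v ∈ p.support,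
      s(w, v) ∉ (p.takeUntil v hv).edges := fun p hp hv he =>
    Walk.endpoint_notMem_support_takeUntil hp hv hwv.ne
      ((p.takeUntil v hv).fst_mem_support_of_mem_edges he)
  by_cases hvp : v ∈ p.support
  · exact exists_disjoint_walks_of_takeUntil hwv p q hpq hvp .nil (by simp) (by simp)
      (hnot p hp hvp)
  by_cases hvq : v ∈ q.support
  · exact exists_disjoint_walks_of_takeUntil hwv q p hpq.symm hvq .nil (by simp) (by simp)
      (hnot q hq hvq)
  obtain ⟨r₀, hr₀⟩ := reachable_deleteEdges_iff_exists_walk.1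
    (isEdgeReachable_two.1 (hG v u) s(w, v))
  -- A walk from `v` to `u` avoiding the edge `wv` is cut at its first vertex `z` on `p` or `q`. The
  -- path through `z` is diverted there to `v`; the other one is prolonged by `wv`.
  obtain ⟨z, hz, hzr, hzu⟩ := r₀.exists_mem_support_forall_mem_support_imp_eq
    (p.support.toFinset ∪ q.support.toFinset) ⟨u, Finset.mem_filter.2 ⟨by simp, by simp⟩⟩
  set r := (r₀.takeUntil z hzr).reverse with hr
  have hrwv : s(w, v) ∉ r.edges := fun he => hr₀ (r₀.edges_takeUntil_subset_edges hzr (by simpa [hr] using he))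
  have hout : ∀ e ∈ r.edges, e ∉ p.edges ∧ e ∉ q.edges := by
    intro e
    induction e with
    | h a b =>
      intro he
      have ha := r.fst_mem_support_of_mem_edges he
      have hb := r.snd_mem_support_of_mem_edges he
      have hab : a ≠ b := (r.adj_of_mem_edges he).ne
      rw [hr, Walk.support_reverse, List.mem_reverse] at ha hb
      constructor <;> intro he'
      · have h1 := hzu a (by simp [Walk.fst_mem_support_of_mem_edges _ he']) ha
        have h2 := hzu b (by simp [Walk.snd_mem_support_of_mem_edges _ he']) hb
        exact hab (h1.trans h2.symm)
      · have h1 := hzu a (by simp [Walk.fst_mem_support_of_mem_edges _ he']) ha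
        have h2 := hzu b (by simp [Walk.snd_mem_support_of_mem_edges _ he']) hb
        exact hab (h1.trans h2.symm)
  rw [Finset.mem_union, List.mem_toFinset, List.mem_toFinset] at hz
  rcases hz with hz | hz
  · exact exists_disjoint_walks_of_takeUntil hwv p q hpq hz r (fun e he he' => (hout e he).2 he')
      hrwv (fun he => hvp (Walk.snd_mem_support_of_mem_edges _ (p.edges_takeUntil_subset_edges hz he)))
  · exact exists_disjoint_walks_of_takeUntil hwv q p hpq.symm hz r
      (fun e he he' => (hout e he).1 he')
      hrwv (fun he => hvq (Walk.snd_mem_support_of_mem_edges _ (q.edges_takeUntil_subset_edges hz he)))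

/-- Any two vertices of a `2`-edge-connected graph are joined by two edge-disjoint paths. -/
theorem IsEdgeConnected.exists_disjoint_paths (hG : G.IsEdgeConnected 2) (u v : V) :
    ∃ p q : G.Path u v, (p : G.Walk u v).edges.Disjoint (q : G.Walk u v).edges := by
  classical
  have key : ∀ {a b : V}, G.Walk a b → (∃ p q : G.Walk u a, p.edges.Disjoint q.edges) →
      ∃ p q : G.Walk u b, p.edges.Disjoint q.edges := by
    intro a b p
    induction p with
    | nil => exact id
    | cons h p ih => exact fun ha => ih (exists_disjoint_walks_step hG h ha)
  obtain ⟨r⟩ := (hG u v).reachable (by simp)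
  obtain ⟨p, q, hpq⟩ := key r ⟨.nil, .nil, by simp⟩
  exact ⟨p.toPath, q.toPath, fun e he he' =>
    hpq (p.edges_toPath_subset_edges he) (q.edges_toPath_subset_edges he')⟩

/-- A monochromatic 2-edge-connected spanning subgraph already supplies both paths for every pair,
so the other edges may be coloured freely. -/
theorem isMCColoring_two_of_forall_eq (hHG : H ≤ G) (hH : H.IsEdgeConnected 2)
    {Γ : G.edgeSet → ℕ} {c : ℕ} (hΓ : ∀ e : G.edgeSet, (e : Sym2 V) ∈ H.edgeSet → Γ e = c) :
    IsMCColoring 2 Γ := by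
  intro u v _
  obtain ⟨p, q, hpq⟩ := hH.exists_disjoint_paths u v
  have hmono : ∀ p : H.Path u v, ((p : H.Walk u v).mapLe hHG).IsMonochromatic Γ := fun p =>
    ⟨c, fun e he => hΓ _ ((p : H.Walk u v).edges_subset_edgeSet (by simpa using he))⟩
  refine ⟨![⟨(p : H.Walk u v).mapLe hHG, p.2.mapLe hHG⟩,
    ⟨(q : H.Walk u v).mapLe hHG, q.2.mapLe hHG⟩], ?_, ?_⟩
  · intro i
    fin_cases i
    · exact hmono p
    · exact hmono q
  · intro i j hij
    fin_cases i <;> fin_cases j <;> simp_all [List.disjoint_comm]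

theorem mem_mcColorCounts_two [Finite V] (hHG : H ≤ G) (hH : H.IsEdgeConnected 2)
    (hne : H ≠ ⊥) : G.edgeSet.ncard - H.edgeSet.ncard + 1 ∈ mcColorCounts 2 G := by
  classical
  obtain ⟨f, hf⟩ := Countable.exists_injective_nat G.edgeSet
  -- The shift by one reserves colour `0` for `H`; this colour is really used because `H ≠ ⊥`.
  set Γ : G.edgeSet → ℕ := fun e => if (e : Sym2 V) ∈ H.edgeSet then 0 else f e + 1 with hΓ
  refine ⟨Γ, isMCColoring_two_of_forall_eq hHG hH (c := 0) fun e he => if_pos he, ?_⟩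
  obtain ⟨e₀, he₀⟩ := edgeSet_nonempty.2 hne
  have hsub : H.edgeSet ⊆ G.edgeSet := edgeSet_subset_edgeSet.2 hHG
  have hrange : Set.range Γ =
      insert 0 ((fun e => f e + 1) '' {e : G.edgeSet | (e : Sym2 V) ∉ H.edgeSet}) := by
    ext m
    simp only [Set.mem_range, Set.mem_insert_iff, Set.mem_image]
    constructor
    · rintro ⟨e, rfl⟩
      by_cases he : (e : Sym2 V) ∈ H.edgeSet
      · exact Or.inl (if_pos he)
      · exact Or.inr ⟨e, he, (if_neg he).symm⟩
    · rintro (rfl | ⟨e, he, rfl⟩)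
      · exact ⟨⟨e₀, hsub he₀⟩, if_pos he₀⟩
      · exact ⟨e, if_neg he⟩
  have hinj : Function.Injective (fun e => f e + 1) := fun a b hab => hf (by simpa using hab)
  rw [hrange, Set.ncard_insert_of_notMem (by simp) (Set.toFinite _),
    Set.ncard_image_of_injective _ hinj, ← Set.ncard_sdiff hsub (Set.toFinite _),
    ← Set.ncard_image_of_injective _ Subtype.val_injective]
  congr 2
  ext e
  simp [and_comm]

/-- The edges of colour `c`. -/
def colorGraph (Γ : G.edgeSet → ℕ) (c : ℕ) : SimpleGraph V where
  Adj u v := ∃ h : G.Adj u v, Γ ⟨s(u, v), h⟩ = c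
  symm := ⟨fun u v ⟨h, hc⟩ => ⟨h.symm, by rw [← hc]; congr 2; exact Sym2.eq_swap⟩⟩
  loopless := ⟨fun _ h => h.1.ne rfl⟩

/-- The edges of colour `c` in the component with vertex set `X`. -/
def colorPiece (Γ : G.edgeSet → ℕ) (i : ℕ × Set V) : SimpleGraph V where
  Adj u v := (colorGraph Γ i.1).Adj u v ∧ {x | (colorGraph Γ i.1).Reachable u x} = i.2
  symm := ⟨fun u v ⟨h, hX⟩ => ⟨h.symm, by
    rw [← hX]
    ext x
    exact ⟨fun hx => h.reachable.trans hx, fun hx => h.symm.reachable.trans hx⟩⟩⟩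
  loopless := ⟨fun _ h => h.1.ne rfl⟩

theorem mem_edgeSet_colorPiece {Γ : G.edgeSet → ℕ} {c : ℕ} {u v : V}
    (p : (colorGraph Γ c).Walk u v) {e : Sym2 V} (he : e ∈ p.edges) :
    e ∈ (colorPiece Γ (c, {x | (colorGraph Γ c).Reachable u x})).edgeSet := by
  classical
  induction e with
  | h a b =>
    have hr : (colorGraph Γ c).Reachable u a :=
      ⟨p.takeUntil a (p.fst_mem_support_of_mem_edges he)⟩
    refine ⟨p.adj_of_mem_edges he, ?_⟩
    ext x
    exact ⟨fun hx => hr.trans hx, fun hx => hr.symm.trans hx⟩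

/-- Each of the two monochromatic paths lies in one piece. In a common piece, disjointness lets one
of them survive the deletion of any edge; otherwise two pieces connect the pair. -/
theorem isColorFamily_colorPiece {Γ : G.edgeSet → ℕ} (hΓ : IsMCColoring 2 Γ) :
    IsColorFamily G (fun i : {i : ℕ × Set V // colorPiece Γ i ≠ ⊥} => colorPiece Γ i) where
  le i u v h := h.1.1
  eq_of_adj {i j u v} hi hj := by
    obtain ⟨⟨h, hi1⟩, hi2⟩ := hi
    obtain ⟨⟨h', hj1⟩, hj2⟩ := hj
    have h1 : i.1.1 = j.1.1 := hi1.symm.trans hj1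
    refine Subtype.ext (Prod.ext h1 ?_)
    rw [← hi2, ← hj2, h1]
  ne_bot i := i.2
  reachable {i u v} hu hv := by
    obtain ⟨u', hu⟩ := hu
    obtain ⟨v', hv⟩ := hv
    have hvX : v ∈ i.1.2 := by
      rw [← hv.2]
      exact Reachable.rfl
    rw [← hu.2] at hvX
    obtain ⟨p⟩ := hvX
    have hi : (i : ℕ × Set V) = (i.1.1, {x | (colorGraph Γ i.1.1).Reachable u x}) :=
      Prod.ext rfl hu.2.symm
    refine ⟨p.transfer _ fun e he => ?_⟩
    rw [hi]
    exact mem_edgeSet_colorPiece p he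
  cover {u v} hne := by
    obtain ⟨P, hmono, hdisj⟩ := hΓ u v hne
    have hpiece : ∀ k, ∃ i : {i : ℕ × Set V // colorPiece Γ i ≠ ⊥},
        ∀ e ∈ (P k : G.Walk u v).edges, e ∈ (colorPiece Γ i).edgeSet := by
      intro k
      obtain ⟨c, hc⟩ := hmono k
      have hcg : ∀ e ∈ (P k : G.Walk u v).edges, e ∈ (colorGraph Γ c).edgeSet := by
        intro e
        induction e with
        | h a b => exact fun he => ⟨(P k : G.Walk u v).adj_of_mem_edges he, hc _ he⟩
      have hall := fun e (he : e ∈ (P k : G.Walk u v).edges) =>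
        mem_edgeSet_colorPiece ((P k : G.Walk u v).transfer _ hcg) (by simpa using he)
      refine ⟨⟨(c, {x | (colorGraph Γ c).Reachable u x}), fun hbot => ?_⟩, hall⟩
      have hnil : ¬ (P k : G.Walk u v).Nil := Walk.not_nil_of_ne hne
      have := hall _ ((P k : G.Walk u v).mk_start_snd_mem_edges hnil)
      rw [hbot] at this
      simp at this
    choose i hi using hpiece
    by_cases h01 : i 0 = i 1
    · refine Or.inl ⟨i 0, isEdgeReachable_two.2 fun e => ?_⟩
      by_cases he : e ∈ (P 0 : G.Walk u v).edges
      · refine ⟨(P 1 : G.Walk u v).transfer _ fun e' he' => ?_⟩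
        rw [edgeSet_deleteEdges]
        refine ⟨h01 ▸ hi 1 e' he', ?_⟩
        rintro rfl
        exact hdisj 0 1 (by simp) he he'
      · refine ⟨(P 0 : G.Walk u v).transfer _ fun e' he' => ?_⟩
        rw [edgeSet_deleteEdges]
        refine ⟨hi 0 e' he', ?_⟩
        rintro rfl
        exact he he'
    · exact Or.inr ⟨i 0, i 1, h01, ⟨(P 0 : G.Walk u v).transfer _ (hi 0)⟩,
        ⟨(P 1 : G.Walk u v).transfer _ (hi 1)⟩⟩

theorem IsColorFamily.sum_edgeExcess_add_card_le [Fintype V] {ι : Type*} [Fintype ι]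
    {C : ι → SimpleGraph V} (h : IsColorFamily G C) :
    ∑ i, (C i).edgeExcess + Fintype.card ι ≤ G.edgeSet.ncard := by
  classical
  rw [← Finset.card_univ, Finset.card_eq_sum_ones, ← Finset.sum_add_distrib,
    Finset.sum_congr rfl fun i _ => h.edgeExcess_add_one i]
  simp only [Set.ncard_eq_toFinset_card']
  rw [← Finset.card_biUnion]
  · refine Finset.card_le_card fun e he => ?_
    obtain ⟨i, -, he⟩ := Finset.mem_biUnion.1 he
    rw [Set.mem_toFinset] at he ⊢
    exact edgeSet_subset_edgeSet.2 (h.le i) he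
  · intro i _ j _ hij
    rw [Function.onFun, Finset.disjoint_left]
    intro e
    induction e with
    | h a b =>
      intro hi hj
      rw [Set.mem_toFinset] at hi hj
      exact hij (h.eq_of_adj hi hj)

/-- The number of colours of an `MC_2`-colouring is bounded in terms of the number of edges of some
`2`-edge-connected spanning subgraph. -/
theorem IsMCColoring.exists_isEdgeConnected_two [Finite V] [Nonempty V] {Γ : G.edgeSet → ℕ}
    (hΓ : IsMCColoring 2 Γ) (hG : G.IsEdgeConnected 2) :
    ∃ H ≤ G, H.IsEdgeConnected 2 ∧
      (Set.range Γ).ncard + H.edgeSet.ncard ≤ G.edgeSet.ncard + 1 := by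
  classical
  have := Fintype.ofFinite V
  have hfam := isColorFamily_colorPiece hΓ
  have hadj : ∀ e : G.edgeSet, ∃ i : {i : ℕ × Set V // colorPiece Γ i ≠ ⊥},
      i.1.1 = Γ e ∧ (e : Sym2 V) ∈ (colorPiece Γ i).edgeSet := by
    rintro ⟨e, he⟩
    induction e with
    | h a b =>
      have hab : (colorGraph Γ (Γ ⟨s(a, b), he⟩)).Adj a b := ⟨he, rfl⟩
      have h1 := mem_edgeSet_colorPiece (Walk.cons hab .nil) (e := s(a, b)) (by simp)
      refine ⟨⟨_, fun hbot => ?_⟩, rfl, h1⟩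
      rw [hbot] at h1
      simp at h1
  -- The index type is infinite, but nonempty pieces have disjoint edge sets, so choosing an edge in
  -- each is injective.
  have hfin : Finite {i : ℕ × Set V // colorPiece Γ i ≠ ⊥} := by
    have hex : ∀ i : {i : ℕ × Set V // colorPiece Γ i ≠ ⊥}, ∃ e, e ∈ (colorPiece Γ i).edgeSet :=
      fun i => edgeSet_nonempty.2 i.2
    choose g hg using hex
    refine Finite.of_injective g fun i j hij => ?_
    have hi := hg i
    have hj := hg j
    rw [← hij] at hj
    generalize g i = e at hi hj
    induction e with
    | h a b => exact hfam.eq_of_adj hi hj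
  have := Fintype.ofFinite {i : ℕ × Set V // colorPiece Γ i ≠ ⊥}
  obtain ⟨H, hHG, hH, hle⟩ := hfam.exists_spanning_isEdgeConnected_two hG
  refine ⟨H, hHG, hH, ?_⟩
  have h1 := hfam.sum_edgeExcess_add_card_le
  have h2 : (Set.range Γ).ncard ≤ Fintype.card {i : ℕ × Set V // colorPiece Γ i ≠ ⊥} := by
    rw [← Nat.card_eq_fintype_card, ← Set.ncard_univ]
    have hsub : Set.range Γ ⊆
        (fun i : {i : ℕ × Set V // colorPiece Γ i ≠ ⊥} => i.1.1) '' Set.univ := by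
      rintro _ ⟨e, rfl⟩
      obtain ⟨i, hi, -⟩ := hadj e
      exact ⟨i, trivial, hi⟩
    exact (Set.ncard_le_ncard hsub (Set.toFinite _)).trans (Set.ncard_image_le (Set.toFinite _))
  omega

theorem IsEdgeConnected.ne_bot [Nontrivial V] (hH : H.IsEdgeConnected 2) : H ≠ ⊥ := by
  obtain ⟨u, v, huv⟩ := exists_pair_ne V
  obtain ⟨w, hw, -⟩ := exists_adj_isEdgeReachable_two huv (hH u v)
  exact ne_bot_iff_exists_adj.2 ⟨u, w, hw⟩

theorem IsEdgeConnected.mcColorCounts_two_nonempty (hG : G.IsEdgeConnected 2) :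
    (mcColorCounts 2 G).Nonempty :=
  ⟨_, fun _ => 0, isMCColoring_two_of_forall_eq le_rfl hG fun _ _ => rfl, rfl⟩

/-- `mc_2(G) = e(G) - e(H) + 1` for a minimum `2`-edge-connected spanning subgraph `H` of `G`. -/
theorem IsEdgeConnected.exists_mc_two_add_eq [Finite V] [Nontrivial V]
    (hG : G.IsEdgeConnected 2) :
    ∃ H ≤ G, H.IsEdgeConnected 2 ∧ mc 2 G + H.edgeSet.ncard = G.edgeSet.ncard + 1 ∧
      ∀ H' ≤ G, H'.IsEdgeConnected 2 → H.edgeSet.ncard ≤ H'.edgeSet.ncard := by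
  have hmax := mc_isGreatest 2 G hG.mcColorCounts_two_nonempty
  obtain ⟨Γ, hΓ, hm⟩ := hmax.1
  obtain ⟨H, hHG, hH, hle⟩ := hΓ.exists_isEdgeConnected_two hG
  have hlow : ∀ H' ≤ G, H'.IsEdgeConnected 2 →
      G.edgeSet.ncard + 1 ≤ mc 2 G + H'.edgeSet.ncard := by
    intro H' hH'G hH'
    have := hmax.2 (mem_mcColorCounts_two hH'G hH' hH'.ne_bot)
    have := Set.ncard_le_ncard (edgeSet_subset_edgeSet.2 hH'G) (Set.toFinite _)
    omega
  have := hlow H hHG hH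
  refine ⟨H, hHG, hH, by omega, fun H' hH'G hH' => ?_⟩
  have := hlow H' hH'G hH'
  omega

end MonochromaticNumber

end SimpleGraph


/-! ### Transfer along embeddings -/

namespace SimpleGraph

section Map

variable {V W : Type*} {K : SimpleGraph V}

theorem reachable_map_iff (f : V ↪ W) {x y : V} :
    (K.map f).Reachable (f x) (f y) ↔ K.Reachable x y := by
  refine ⟨fun ⟨p⟩ => ?_, fun h => h.map (Embedding.map f K).toHom⟩
  have key : ∀ {a b : W} (_ : (K.map f).Walk a b) (x y : V), f x = a → f y = b →
      K.Reachable x y := by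
    intro a b p
    induction p with
    | nil =>
      rintro x y rfl hy
      rw [f.injective hy]
    | cons h p ih =>
      rintro x y rfl hy
      obtain ⟨x', c, hxc, hx, rfl⟩ := (map_adj _ _ _ _).1 h
      rw [f.injective hx] at hxc
      exact hxc.reachable.trans (ih c y rfl hy)
  exact key p x y rfl rfl

theorem map_deleteEdges (f : V ↪ W) (s : Set (Sym2 W)) :
    (K.map f).deleteEdges s = (K.deleteEdges (Sym2.map f ⁻¹' s)).map f := by
  ext a b
  simp only [deleteEdges_adj, map_adj, Set.mem_preimage]
  constructor
  · rintro ⟨⟨x, y, h, rfl, rfl⟩, hs⟩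
    exact ⟨x, y, ⟨h, hs⟩, rfl, rfl⟩
  · rintro ⟨x, y, ⟨h, hs⟩, rfl, rfl⟩
    exact ⟨⟨x, y, h, rfl, rfl⟩, hs⟩

theorem isEdgeReachable_map_iff (f : V ↪ W) {k : ℕ} {x y : V} :
    (K.map f).IsEdgeReachable k (f x) (f y) ↔ K.IsEdgeReachable k x y := by
  have hf := Sym2.map.injective f.injective
  constructor
  · intro h s hs
    have := h (s := Sym2.map f '' s) (by rwa [hf.encard_image])
    rwa [map_deleteEdges, Set.preimage_image_eq _ hf, reachable_map_iff] at this
  · intro h s hs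
    rw [map_deleteEdges, reachable_map_iff]
    refine h (lt_of_le_of_lt ?_ hs)
    rw [← hf.encard_image]
    exact Set.encard_le_encard (Set.image_preimage_subset _ _)

theorem ncard_edgeSet_map (f : V ↪ W) : (K.map f).edgeSet.ncard = K.edgeSet.ncard := by
  rw [edgeSet_map]
  exact Set.ncard_image_of_injective _ f.sym2Map.injective

end Map

/-! ### Blocks and 2-edge-connected subgraphs -/

namespace Subgraph

variable {V : Type*} {G : SimpleGraph V} {A B : G.Subgraph}

/-- Moves connectivity to graphs on `V`, where subgraphs with different vertex sets can be compared
by monotonicity. -/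
theorem preconnected_iff_forall_reachable :
    B.Preconnected ↔ ∀ x ∈ B.verts, ∀ y ∈ B.verts, B.spanningCoe.Reachable x y := by
  rw [Subgraph.preconnected_iff, ← spanningCoe_coe]
  exact ⟨fun h x hx y hy => (reachable_map_iff (.subtype _)).2 (h ⟨x, hx⟩ ⟨y, hy⟩),
    fun h x y => (reachable_map_iff (.subtype _)).1 (h x x.2 y y.2)⟩

theorem spanningCoe_deleteVerts_adj {z a b : V} :
    (B.deleteVerts {z}).spanningCoe.Adj a b ↔ B.Adj a b ∧ a ≠ z ∧ b ≠ z := by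
  simp only [spanningCoe_adj, deleteVerts_adj, Set.mem_singleton_iff]
  exact ⟨fun h => ⟨h.2.2.2.2, h.2.1, h.2.2.2.1⟩,
    fun h => ⟨h.1.fst_mem, h.2.1, h.1.snd_mem, h.2.2, h.1⟩⟩

theorem spanningCoe_deleteVerts_mono (h : A ≤ B) (z : V) :
    (A.deleteVerts {z}).spanningCoe ≤ (B.deleteVerts {z}).spanningCoe := fun _ _ hab =>
  spanningCoe_deleteVerts_adj.2
    ⟨h.2 (spanningCoe_deleteVerts_adj.1 hab).1, (spanningCoe_deleteVerts_adj.1 hab).2⟩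

theorem IsNonseparable.reachable_deleteVerts (hB : B.IsNonseparable) {x y z : V}
    (hx : x ∈ B.verts) (hy : y ∈ B.verts) (hxz : x ≠ z) (hyz : y ≠ z) :
    (B.deleteVerts {z}).spanningCoe.Reachable x y := by
  by_cases hz : z ∈ B.verts
  · exact preconnected_iff_forall_reachable.1 (hB.2 z hz) x ⟨hx, hxz⟩ y ⟨hy, hyz⟩
  · refine (preconnected_iff_forall_reachable.1 hB.1.preconnected x hx y hy).mono fun a b hab => ?_
    exact spanningCoe_deleteVerts_adj.2
      ⟨hab, fun h => hz (h ▸ hab.fst_mem), fun h => hz (h ▸ hab.snd_mem)⟩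

/-- After the deletion of `z`, every remaining vertex of `A` still escapes to a vertex of `B`, and
what is left of `B` is connected. -/
theorem IsNonseparable.sup (hB : B.IsNonseparable) (hA : A.Connected)
    (hAB : (B.verts ∩ A.verts).Nonempty)
    (h : ∀ z, ∀ x ∈ A.verts, x ≠ z →
      ∃ w ∈ B.verts, w ≠ z ∧ (A.deleteVerts {z}).spanningCoe.Reachable x w) :
    (B ⊔ A).IsNonseparable := by
  refine ⟨connected_sup hB.1.preconnected hA.preconnected hAB,
    fun z _ => preconnected_iff_forall_reachable.2 ?_⟩
  have key : ∀ x ∈ (B ⊔ A).verts, x ≠ z →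
      ∃ w ∈ B.verts, w ≠ z ∧ ((B ⊔ A).deleteVerts {z}).spanningCoe.Reachable x w := by
    rintro x (hx | hx) hxz
    · exact ⟨x, hx, hxz, .rfl⟩
    · obtain ⟨w, hw, hwz, hr⟩ := h z x hx hxz
      exact ⟨w, hw, hwz, hr.mono (spanningCoe_deleteVerts_mono le_sup_right z)⟩
  rintro x ⟨hx, hxz⟩ y ⟨hy, hyz⟩
  obtain ⟨w, hw, hwz, hxw⟩ := key x hx hxz
  obtain ⟨w', hw', hwz', hyw⟩ := key y hy hyz
  exact hxw.trans (((hB.reachable_deleteVerts hw hw' hwz hwz').mono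
    (spanningCoe_deleteVerts_mono le_sup_left z)).trans hyw.symm)

theorem IsBlock.le_of_sup (hB : B.IsBlock) (h : (B ⊔ A).IsNonseparable) : A ≤ B :=
  le_sup_right.trans (hB.2 h le_sup_left)

/-- Of two common vertices, at least one survives the deletion of `z` and serves as the escape, so
the union is nonseparable and maximality applies. -/
theorem IsBlock.eq_of_mem_verts (hA : A.IsBlock) (hB : B.IsBlock) {u v : V} (huv : u ≠ v)
    (huA : u ∈ A.verts) (hvA : v ∈ A.verts) (huB : u ∈ B.verts) (hvB : v ∈ B.verts) : A = B := by
  have key : ∀ {A B : G.Subgraph}, A.IsBlock → B.IsBlock → u ∈ A.verts → v ∈ A.verts →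
      u ∈ B.verts → v ∈ B.verts → A ≤ B := by
    intro A B hA hB huA hvA huB hvB
    refine hB.le_of_sup (hB.1.sup hA.1.1 ⟨u, huB, huA⟩ fun z x hx hxz => ?_)
    by_cases huz : u = z
    · exact ⟨v, hvB, huz ▸ huv.symm, hA.1.reachable_deleteVerts hx hvA hxz (huz ▸ huv.symm)⟩
    · exact ⟨u, huB, huz, hA.1.reachable_deleteVerts hx huA hxz huz⟩
  exact le_antisymm (key hA hB huA hvA huB hvB) (key hB hA huB hvB huA hvA)

/-- Deleting a vertex of the path leaves every other path vertex connected along it to an end, which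
is in `B`. Hence adding the path keeps `B` nonseparable. -/
theorem IsBlock.toSubgraph_le (hB : B.IsBlock) {u v : V} (hu : u ∈ B.verts)
    (hv : v ∈ B.verts) {p : G.Walk u v} (hp : p.IsPath) : p.toSubgraph ≤ B := by
  classical
  have key : ∀ {z a b : V} (q : G.Walk a b), (∀ e ∈ q.edges, e ∈ p.edges) → z ∉ q.support →
      (p.toSubgraph.deleteVerts {z}).spanningCoe.Reachable a b := by
    intro z a b q hq hz
    refine ⟨q.transfer _ fun e he => ?_⟩
    induction e with
    | h c d =>
      refine spanningCoe_deleteVerts_adj.2 ⟨?_, ?_, ?_⟩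
      · exact Walk.adj_toSubgraph_iff_mem_edges.2 (hq _ he)
      · rintro rfl
        exact hz (q.fst_mem_support_of_mem_edges he)
      · rintro rfl
        exact hz (q.snd_mem_support_of_mem_edges he)
  refine hB.le_of_sup (hB.1.sup p.toSubgraph_connected ⟨u, hu, p.start_mem_verts_toSubgraph⟩
    fun z x hx hxz => ?_)
  rw [Walk.mem_verts_toSubgraph] at hx
  by_cases hz : z ∈ (p.takeUntil x hx).support
  · have hz' : z ∉ (p.dropUntil x hx).support := by
      intro hz'
      have hnd := hp.support_nodup
      rw [← p.take_spec hx, Walk.support_append, List.nodup_append] at hnd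
      rcases (Walk.mem_support_iff _).1 hz' with rfl | hz'
      · exact hxz rfl
      · exact hnd.2.2 z hz z hz' rfl
    exact ⟨v, hv, fun h => hz' (h ▸ Walk.end_mem_support _),
      key _ (fun e he => p.edges_dropUntil_subset_edges hx he) hz'⟩
  · exact ⟨u, hu, fun h => hz (h ▸ Walk.start_mem_support _),
      (key _ (fun e he => p.edges_takeUntil_subset_edges hx he) hz).symm⟩

/-- Paths of `H` between vertices of a block stay in the block, including those that avoid a given
edge. -/
theorem IsBlock.isEdgeReachable_two_inf (hB : B.IsBlock) {H : SimpleGraph V} (hHG : H ≤ G)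
    (hH : H.IsEdgeConnected 2) {x y : V} (hx : x ∈ B.verts) (hy : y ∈ B.verts) :
    (H ⊓ B.spanningCoe).IsEdgeReachable 2 x y := by
  refine isEdgeReachable_two.2 fun e => ?_
  obtain ⟨p, hp⟩ := (isEdgeReachable_two.1 (hH x y) e).exists_isPath
  have hle : H.deleteEdges {e} ≤ G := (H.deleteEdges_le _).trans hHG
  have hpB := hB.toSubgraph_le hx hy (hp.mapLe hle)
  refine ⟨p.transfer _ fun d hd => ?_⟩
  have hdH := p.edges_subset_edgeSet hd
  have hdB : d ∈ B.edgeSet := edgeSet_mono hpB (by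
    rw [Walk.mem_edges_toSubgraph, Walk.edges_mapLe_eq_edges]; exact hd)
  rw [edgeSet_deleteEdges] at hdH ⊢
  rw [SimpleGraph.edgeSet_inf]
  exact ⟨⟨hdH.1, hdB⟩, hdH.2⟩

theorem isNonseparable_subgraphOfAdj {u v : V} (h : G.Adj u v) :
    (G.subgraphOfAdj h).IsNonseparable := by
  refine ⟨subgraphOfAdj_connected h, fun z hz => preconnected_iff_forall_reachable.2 ?_⟩
  rintro x ⟨hx, hxz⟩ y ⟨hy, hyz⟩
  have : x = y := by
    simp only [subgraphOfAdj_verts, Set.mem_insert_iff, Set.mem_singleton_iff] at hx hy hz hxz hyz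
    grind
  rw [this]

theorem IsNonseparable.exists_isBlock_ge [Finite V] (hA : A.IsNonseparable) :
    ∃ B, A ≤ B ∧ B.IsBlock :=
  Set.Finite.exists_le_maximal (Set.toFinite _) hA

theorem exists_isBlock_adj [Finite V] {u v : V} (h : G.Adj u v) :
    ∃ B : G.Subgraph, B.IsBlock ∧ B.Adj u v := by
  obtain ⟨B, hle, hB⟩ := (isNonseparable_subgraphOfAdj h).exists_isBlock_ge
  exact ⟨B, hB, (subgraphOfAdj_le_iff h B).1 hle⟩

theorem IsBlock.nontrivial_verts [Nontrivial V] (hG : G.Connected) (hB : B.IsBlock) :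
    Nontrivial B.verts := by
  obtain ⟨u, hu⟩ := hB.1.1.nonempty
  by_contra h
  rw [not_nontrivial_iff_subsingleton, Set.subsingleton_coe] at h
  obtain ⟨v, huv⟩ := hG.preconnected.exists_adj_of_nontrivial u
  have hle : B ≤ G.subgraphOfAdj huv := by
    refine ⟨fun x hx => ?_, fun x y hxy => ?_⟩
    · simp [h hx hu]
    · exact absurd (h hxy.fst_mem hxy.snd_mem) hxy.ne
  have hv : v ∈ B.verts := (hB.2 (isNonseparable_subgraphOfAdj huv) hle).1 (by simp)
  exact huv.ne (h hu hv)

theorem IsBlock.isEdgeConnected_two_comap (hB : B.IsBlock) {H : SimpleGraph V} (hHG : H ≤ G)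
    (hH : H.IsEdgeConnected 2) :
    ((H ⊓ B.spanningCoe).comap (Function.Embedding.subtype (· ∈ B.verts))).IsEdgeConnected 2 := by
  intro x y
  rw [← isEdgeReachable_map_iff (.subtype (· ∈ B.verts))]
  refine (hB.isEdgeReachable_two_inf hHG hH x.2 y.2).mono fun a b hab => ?_
  exact (SimpleGraph.map_adj _ _ _ _).2 ⟨⟨a, hab.2.fst_mem⟩, ⟨b, hab.2.snd_mem⟩, hab, rfl, rfl⟩

theorem map_comap_inf_spanningCoe (H : SimpleGraph V) (B : G.Subgraph) :
    ((H ⊓ B.spanningCoe).comap (Function.Embedding.subtype (· ∈ B.verts))).map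
      (Function.Embedding.subtype (· ∈ B.verts)) = H ⊓ B.spanningCoe := by
  refine le_antisymm (map_comap_le _ _) fun a b hab => ?_
  exact (SimpleGraph.map_adj _ _ _ _).2 ⟨⟨a, hab.2.fst_mem⟩, ⟨b, hab.2.snd_mem⟩, hab, rfl, rfl⟩

theorem IsBlock.isEdgeConnected_two_coe (hB : B.IsBlock) (hG : G.IsEdgeConnected 2) :
    B.coe.IsEdgeConnected 2 := by
  intro x y
  rw [← isEdgeReachable_map_iff (.subtype (· ∈ B.verts))]
  refine (hB.isEdgeReachable_two_inf le_rfl hG x.2 y.2).mono ?_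
  rw [← spanningCoe_coe]
  exact inf_le_right

end Subgraph

end SimpleGraph


/-! ### Adding up over the blocks -/

namespace SimpleGraph

section BlockDecomposition

variable {V : Type*} {G : SimpleGraph V}

theorem IsEdgeConnected.card_le_ncard_edgeSet [Finite V] [Nontrivial V]
    (hG : G.IsEdgeConnected 2) : Nat.card V ≤ G.edgeSet.ncard := by
  obtain ⟨u, v, huv⟩ := exists_pair_ne V
  have h : {w | G.Reachable u w} = Set.univ :=
    Set.eq_univ_of_forall fun w => (hG u w).reachable two_ne_zero
  rw [← Set.ncard_univ, ← h]
  exact ncard_reachable_le_of_isEdgeReachable_two huv (hG u v)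

theorem isEdgeConnected_iSup_map [Nonempty V] (hG : G.Connected) {ι : Type*} {B : ι → G.Subgraph}
    (hcover : ∀ {u v}, G.Adj u v → ∃ i, (B i).Adj u v) {k : ℕ}
    {K : ∀ i, SimpleGraph (B i).verts} (hK : ∀ i, (K i).IsEdgeConnected k) :
    (⨆ i, (K i).map (Function.Embedding.subtype (· ∈ (B i).verts))).IsEdgeConnected k := by
  have key : ∀ {u v : V}, G.Walk u v →
      (⨆ i, (K i).map (Function.Embedding.subtype (· ∈ (B i).verts))).IsEdgeReachable k u v := by
    intro u v p
    induction p with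
    | nil => exact .rfl
    | cons h p ih =>
      obtain ⟨i, hi⟩ := hcover h
      exact (((isEdgeReachable_map_iff (.subtype (· ∈ (B i).verts))).2
        (hK i ⟨_, hi.fst_mem⟩ ⟨_, hi.snd_mem⟩)).mono
          (le_iSup (fun i => (K i).map (Function.Embedding.subtype (· ∈ (B i).verts))) i)).trans ih
  exact fun u v => key (hG.preconnected u v).some

theorem ncard_edgeSet_iSup_map_le [Finite V] {ι : Type*} [Fintype ι] {B : ι → G.Subgraph}
    (K : ∀ i, SimpleGraph (B i).verts) :
    (⨆ i, (K i).map (Function.Embedding.subtype (· ∈ (B i).verts))).edgeSet.ncard ≤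
      ∑ i, (K i).edgeSet.ncard := by
  rw [edgeSet_iSup]
  refine (Set.ncard_iUnion_le_of_fintype _).trans (Finset.sum_le_sum fun i _ => ?_)
  rw [ncard_edgeSet_map]

theorem iSup_map_le {ι : Type*} {B : ι → G.Subgraph} {K : ∀ i, SimpleGraph (B i).verts}
    (hK : ∀ i, K i ≤ (B i).coe) :
    ⨆ i, (K i).map (Function.Embedding.subtype (· ∈ (B i).verts)) ≤ G := by
  refine iSup_le fun i a b hab => ?_
  obtain ⟨x, y, h, rfl, rfl⟩ := (map_adj _ _ _ _).1 hab
  exact (B i).adj_sub (hK i h)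

theorem ncard_edgeSet_coe (B : G.Subgraph) :
    B.coe.edgeSet.ncard = (G ⊓ B.spanningCoe).edgeSet.ncard := by
  rw [inf_eq_right.2 B.spanningCoe_le, ← Subgraph.spanningCoe_coe]
  exact (ncard_edgeSet_map _).symm

variable [Finite V] {ι : Type*} [Fintype ι] {B : ι → G.Subgraph}

/-- The blocks partition the edges: every edge extends to a block, and two blocks containing both
its ends coincide. -/
theorem ncard_edgeSet_eq_sum_blocks (hinj : Function.Injective B)
    (hB : ∀ H : G.Subgraph, H.IsBlock ↔ ∃ i, B i = H) {H : SimpleGraph V} (hHG : H ≤ G) :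
    H.edgeSet.ncard = ∑ i, (H ⊓ (B i).spanningCoe).edgeSet.ncard := by
  have hun : H.edgeSet = ⋃ i, (H ⊓ (B i).spanningCoe).edgeSet := by
    ext e
    induction e with
    | h a b =>
      simp only [Set.mem_iUnion, mem_edgeSet, inf_adj, Subgraph.spanningCoe_adj]
      refine ⟨fun h => ?_, fun ⟨_, h⟩ => h.1⟩
      obtain ⟨A, hA, hab⟩ := Subgraph.exists_isBlock_adj (hHG h)
      obtain ⟨i, rfl⟩ := (hB A).1 hA
      exact ⟨i, h, hab⟩
  rw [hun, Set.ncard_iUnion_of_finite (fun _ => Set.toFinite _), finsum_eq_sum_of_fintype]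
  intro i j hij
  rw [Function.onFun, Set.disjoint_left]
  intro e
  induction e with
  | h a b =>
    intro hi hj
    have hi' : (B i).Adj a b := hi.2
    have hj' : (B j).Adj a b := hj.2
    exact hij (hinj (((hB _).2 ⟨i, rfl⟩).eq_of_mem_verts ((hB _).2 ⟨j, rfl⟩) hi'.ne
      hi'.fst_mem hi'.snd_mem hj'.fst_mem hj'.snd_mem))

theorem mc_two_blocks_of_nontrivial [Nontrivial V] (hG : G.IsEdgeConnected 2)
    (hinj : Function.Injective B) (hB : ∀ H : G.Subgraph, H.IsBlock ↔ ∃ i, B i = H) :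
    (mc 2 G : ℤ) = (∑ i, (mc 2 (B i).coe : ℤ)) - Fintype.card ι + 1 ∧
      (mc 2 G : ℤ) ≤ (G.edgeSet.ncard : ℤ) - Nat.card V - Fintype.card ι + 2 := by
  have hconn := hG.connected two_ne_zero
  have hblock : ∀ i, (B i).IsBlock := fun i => (hB _).2 ⟨i, rfl⟩
  have hcover : ∀ {u v}, G.Adj u v → ∃ i, (B i).Adj u v := fun h => by
    obtain ⟨A, hA, hab⟩ := Subgraph.exists_isBlock_adj h
    obtain ⟨i, rfl⟩ := (hB A).1 hA
    exact ⟨i, hab⟩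
  have hnt : ∀ i, Nontrivial (B i).verts := fun i => (hblock i).nontrivial_verts hconn
  have hcoe : ∀ i, (B i).coe.IsEdgeConnected 2 := fun i => (hblock i).isEdgeConnected_two_coe hG
  obtain ⟨H, hHG, hH, hmc, hmin⟩ := hG.exists_mc_two_add_eq
  choose K hKB hK hmcK hminK using fun i => (hcoe i).exists_mc_two_add_eq
  have he : G.edgeSet.ncard = ∑ i, (B i).coe.edgeSet.ncard := by
    rw [ncard_edgeSet_eq_sum_blocks hinj hB le_rfl]
    exact Finset.sum_congr rfl fun i _ => (ncard_edgeSet_coe _).symm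
  -- The union of the optimal subgraphs `K i` competes with `H`; conversely, in `hge`, the trace of
  -- `H` on each block competes with `K i`.
  have hle : H.edgeSet.ncard ≤ ∑ i, (K i).edgeSet.ncard :=
    (hmin _ (iSup_map_le hKB) (isEdgeConnected_iSup_map hconn hcover hK)).trans
      (ncard_edgeSet_iSup_map_le K)
  have hge : ∑ i, (K i).edgeSet.ncard ≤ H.edgeSet.ncard := by
    rw [ncard_edgeSet_eq_sum_blocks hinj hB hHG]
    refine Finset.sum_le_sum fun i _ => ?_
    rw [← Subgraph.map_comap_inf_spanningCoe, ncard_edgeSet_map]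
    exact hminK i _ (fun a b hab => hab.2) ((hblock i).isEdgeConnected_two_comap hHG hH)
  have hsum : (∑ i, mc 2 (B i).coe) + ∑ i, (K i).edgeSet.ncard =
      (∑ i, (B i).coe.edgeSet.ncard) + Fintype.card ι := by
    rw [← Finset.sum_add_distrib, Finset.sum_congr rfl fun i _ => hmcK i, Finset.sum_add_distrib]
    simp
  -- Spanning trees of the blocks unite to a connected spanning graph, whence `n - 1 ≤ ∑ (|B i| -
  -- 1)`. Together with `|B i| ≤ e(K i)` this gives `e(H) ≥ n + t - 1`.
  have htree : ∀ i, ∃ T ≤ (B i).coe, T.IsEdgeConnected 1 ∧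
      T.edgeSet.ncard + 1 = Nat.card (B i).verts := fun i => by
    obtain ⟨T, hTB, hT⟩ := ((hcoe i).connected two_ne_zero).exists_isTree_le
    refine ⟨T, hTB, fun u v => isEdgeReachable_one.2 (hT.connected.preconnected u v), ?_⟩
    classical
    have := Fintype.ofFinite (B i).verts
    rw [Nat.card_eq_fintype_card, ← hT.card_edgeFinset, ← coe_edgeFinset, Set.ncard_coe_finset]
  choose T hTB hT hTcard using htree
  have hTG := (isEdgeConnected_iSup_map hconn hcover hT).connected one_ne_zero
  have hn := hTG.card_vert_le_card_edgeSet_add_one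
  rw [Nat.card_coe_set_eq] at hn
  replace hn := hn.trans (Nat.add_le_add_right (ncard_edgeSet_iSup_map_le T) 1)
  have hTK : ∑ i, ((T i).edgeSet.ncard + 1) ≤ ∑ i, (K i).edgeSet.ncard :=
    Finset.sum_le_sum fun i _ => by
      rw [hTcard]
      exact (hK i).card_le_ncard_edgeSet
  rw [Finset.sum_add_distrib] at hTK
  simp only [Finset.sum_const, Finset.card_univ, smul_eq_mul, mul_one] at hTK
  rw [← Nat.cast_sum]
  constructor <;> omega

theorem mc_of_subsingleton [Subsingleton V] {k : ℕ} : mc k G = 0 := by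
  have : IsEmpty G.edgeSet := ⟨fun ⟨e, he⟩ => by
    induction e with
    | h a b => exact he.ne (Subsingleton.elim a b)⟩
  have h : ∀ m ∈ mcColorCounts k G, m = 0 := by
    rintro m ⟨Γ, -, rfl⟩
    rw [Set.range_eq_empty, Set.ncard_empty]
  rcases (mcColorCounts k G).eq_empty_or_nonempty with h0 | h0
  · rw [mc, h0, csSup_empty, bot_eq_zero]
  · exact h _ (mc_isGreatest k G h0).1

/-- The one-vertex graph is its own only block and has no colours, so the claims read `0 = 0 - 1 +
1` and `0 ≤ 0 - 1 - 1 + 2`. -/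
theorem mc_two_blocks_of_subsingleton [Subsingleton V] [Nonempty V]
    (hinj : Function.Injective B) (hB : ∀ H : G.Subgraph, H.IsBlock ↔ ∃ i, B i = H) :
    (mc 2 G : ℤ) = (∑ i, (mc 2 (B i).coe : ℤ)) - Fintype.card ι + 1 ∧
      (mc 2 G : ℤ) ≤ (G.edgeSet.ncard : ℤ) - Nat.card V - Fintype.card ι + 2 := by
  have htop : ∀ A : G.Subgraph, A.verts.Nonempty → A = ⊤ := by
    intro A hA
    refine top_unique ⟨fun v _ => ?_, fun u v huv => absurd (Subsingleton.elim u v) huv.ne⟩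
    obtain ⟨w, hw⟩ := hA
    rwa [Subsingleton.elim v w]
  have hns : (⊤ : G.Subgraph).IsNonseparable := by
    have hpre : ∀ A : G.Subgraph, A.Preconnected := fun A =>
      Subgraph.preconnected_iff_forall_reachable.2 fun x _ y _ => by
        rw [Subsingleton.elim x y]
    exact ⟨Subgraph.connected_iff.2 ⟨hpre _, Set.univ_nonempty⟩, fun _ _ => hpre _⟩
  obtain ⟨i₀, -⟩ := (hB ⊤).1 ⟨hns, fun _ _ _ => le_top⟩
  have : Unique ι := ⟨⟨i₀⟩, fun i => hinj ((htop _ ((hB _).2 ⟨i, rfl⟩).1.1.nonempty).trans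
    (htop _ ((hB _).2 ⟨i₀, rfl⟩).1.1.nonempty).symm)⟩
  have hcard : Nat.card V = 1 := Nat.card_eq_one_iff_unique.2 ⟨inferInstance, inferInstance⟩
  simp only [mc_of_subsingleton, hcard, Fintype.card_unique]
  constructor
  · simp
  · omega

end BlockDecomposition

end SimpleGraph

theorem corollary2p3 {V : Type*} [Finite V] [Nonempty V] (G : SimpleGraph V)
    (hG : G.IsEdgeConnected 2)
    (t : ℕ) (B : Fin t → G.Subgraph) (hB_inj : Function.Injective B)
    (hB : ∀ H : G.Subgraph, H.IsBlock ↔ ∃ i, B i = H) :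
    ((SimpleGraph.mcColorCounts 2 G).Nonempty ∧
      ∀ i, (SimpleGraph.mcColorCounts 2 (B i).coe).Nonempty) ∧
    (SimpleGraph.mc 2 G : ℤ) = (∑ i, (SimpleGraph.mc 2 (B i).coe : ℤ)) - t + 1 ∧
    (SimpleGraph.mc 2 G : ℤ) ≤ (G.edgeSet.ncard : ℤ) - Nat.card V - t + 2 := by
  refine ⟨⟨hG.mcColorCounts_two_nonempty, fun i =>
    (((hB _).2 ⟨i, rfl⟩).isEdgeConnected_two_coe hG).mcColorCounts_two_nonempty⟩, ?_⟩
  rcases subsingleton_or_nontrivial V with h | h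
  · simpa using SimpleGraph.mc_two_blocks_of_subsingleton hB_inj hB
  · simpa using SimpleGraph.mc_two_blocks_of_nontrivial hG hB_inj hB
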